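/- Let $n \ge 1$. A continuous function $u : \mathbb{R}^n \to \mathbb{R}$ is called coordinate-convex if its restriction to every line parallel to a coordinate axis is convex. A coordinate-convex function $u$ is a global viscosity solution of $$\Big(\prod_{i=1}^n u_{ii}\Big)^{1/n} = 1, \qquad u \text{ coordinate-convex}, \tag{$*$}$$ if for every $x_0 \in \mathbb{R}^n$ and every function $\varphi$ of class $C^2$ near $x_0$: (i) if $u - \varphi$ has a local maximum at $x_0$, then $\varphi_{ii}(x_0) \ge 0$ for all $i$ and $\big(\prod_i \varphi_{ii}(x_0)\big)^{1/n} \ge 1$; (ii) if $u - \varphi$ has a local minimum at $x_0$ and $\varphi_{ii}(x_0) \ge 0$ for all $i$, then $\big(\prod_i \varphi_{ii}(x_0)\big)^{1/n} \le 1$. **Theorem.** For every $n \ge 3$ there exists a global viscosity solution $u : \mathbb{R}^n \to \mathbb{R}$ of $(*)$ that is non-classical, i.e. $u \notin C^2(\mathbb{R}^n)$. Moreover, for $n = 3$ such a solution can be found in the form $u(x_1,x_2,x_3) = w(x_1,x_2)\,h(x_3)$, where $h \in C^2(\mathbb{R})$ is positive with $h^2 h'' = 1$ on $\mathbb{R}$,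 and $w : \mathbb{R}^2 \to [0,\infty)$ is coordinate-convex, homogeneous of degree $4/3$ (that is, $w(rx) = r^{4/3} w(x)$ for all $r > 0$), of class $C^2$ on $\mathbb{R}^2 \setminus \{0\}$, and satisfies $w\, w_{11}\, w_{22} = 1$ on $\mathbb{R}^2 \setminus \{0\}$. -/

import Mathlib

/-- The pure second partial derivative `f_ii (x)`: the second derivative at `t = 0` of the
restriction `t ↦ f (x + t e_i)` of `f` to the line through `x` in the `i`-th coordinate
direction. -/
noncomputable def secondPartial {n : ℕ} (f : EuclideanSpace ℝ (Fin n) → ℝ) (i : Fin n)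
    (x : EuclideanSpace ℝ (Fin n)) : ℝ :=
  iteratedDeriv 2 (fun t : ℝ => f (x + t • EuclideanSpace.single i (1 : ℝ))) 0

/-- `f` is coordinate-convex on `ℝⁿ`: it is continuous, and it is convex when restricted to any
line in a coordinate direction. -/
def CoordinateConvex {n : ℕ} (f : EuclideanSpace ℝ (Fin n) → ℝ) : Prop :=
  Continuous f ∧
    ∀ (x : EuclideanSpace ℝ (Fin n)) (i : Fin n),
      ConvexOn ℝ Set.univ (fun t : ℝ => f (x + t • EuclideanSpace.single i (1 : ℝ)))

/-- The operator `(∏ φ_ii)^(1/n)` at the point `x`. It is only used for functions with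
`φ_ii (x) ≥ 0` for all `i`, where it is elliptic. -/
noncomputable def coordinateOperator {n : ℕ} (φ : EuclideanSpace ℝ (Fin n) → ℝ)
    (x : EuclideanSpace ℝ (Fin n)) : ℝ :=
  (∏ i, secondPartial φ i x) ^ (1 / (n : ℝ))

/-- `u` is a viscosity subsolution of `(∏ u_ii)^(1/n) = 1` on `ℝⁿ`: whenever a function `φ`, of
class `C²` near `x₀`, touches `u` from above at `x₀` (up to an additive constant), one has
`φ_ii (x₀) ≥ 0` for all `i` and `(∏ φ_ii (x₀))^(1/n) ≥ 1`. -/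
def IsViscositySubsolution {n : ℕ} (u : EuclideanSpace ℝ (Fin n) → ℝ) : Prop :=
  ∀ (φ : EuclideanSpace ℝ (Fin n) → ℝ) (x₀ : EuclideanSpace ℝ (Fin n)),
    ContDiffAt ℝ 2 φ x₀ → IsLocalMax (fun x => u x - φ x) x₀ →
      (∀ i, 0 ≤ secondPartial φ i x₀) ∧ 1 ≤ coordinateOperator φ x₀

/-- `u` is a viscosity supersolution of `(∏ u_ii)^(1/n) = 1` on `ℝⁿ`: whenever a function `φ`, of
class `C²` near `x₀`, touches `u` from below at `x₀` (up to an additive constant) and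
`φ_ii (x₀) ≥ 0` for all `i`, one has `(∏ φ_ii (x₀))^(1/n) ≤ 1`. -/
def IsViscositySupersolution {n : ℕ} (u : EuclideanSpace ℝ (Fin n) → ℝ) : Prop :=
  ∀ (φ : EuclideanSpace ℝ (Fin n) → ℝ) (x₀ : EuclideanSpace ℝ (Fin n)),
    ContDiffAt ℝ 2 φ x₀ → IsLocalMin (fun x => u x - φ x) x₀ →
      (∀ i, 0 ≤ secondPartial φ i x₀) → coordinateOperator φ x₀ ≤ 1

/-- `u` is a global viscosity solution of `(∏ u_ii)^(1/n) = 1`, `u` coordinate-convex. -/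
def IsGlobalViscositySolution {n : ℕ} (u : EuclideanSpace ℝ (Fin n) → ℝ) : Prop :=
  CoordinateConvex u ∧ IsViscositySubsolution u ∧ IsViscositySupersolution u

/-! Separate variables: for u = w(x₁, x₂) h(x₃) + ∑_{i ≥ 4} xᵢ²/2 the product of the pure second
derivatives is (w w₁₁ w₂₂)(h² h''), so u is a classical solution wherever both factors equal 1. The
equation for w fails only at the origin, that is, for u only on the set x₁ = x₂ = 0.

On that set both viscosity conditions hold for trivial reasons. In the direction x₁, u behaves like
c|t|^(4/3) with c > 0, so no C² function touches it from above (`not_isLocalMax_sub_of_line`); the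
same fact shows that u is not C². In the direction x₃, u is constant because w(0) = 0, so a test
function from below with nonnegative second derivatives has one that vanishes
(`coordinateOperator_le_one_of_flat`).

The degree 4/3 is forced: w w₁₁ w₂₂ has degree 3d - 4, which must be 0. Writing w = |y|^(4/3) V(x/y)
turns the equation into V V'' (4/9 V - 2/3 s V' + s² V'') = 1. A solution with V'(0) = 0 is followed
up to a point S where s V' = 2/3 V (`exists_profile_on_interval`), and S is scaled to 1. These end
conditions are exactly what makes the even reflection at 0 and the inversion s ↦ 1/s at 1 glue to a
C² profile (`exists_isProfile`), whose extension is C² away from the origin. -/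

open Set Filter Topology

/-! ### Second-order comparison in one variable -/

/-- One-dimensional second order comparison at a local maximum of a difference. -/
theorem secondDeriv_le_of_isLocalMax_sub {f f' φ : ℝ → ℝ} {a : ℝ}
    (hf : ∀ᶠ t in 𝓝 0, HasDerivAt f (f' t) t) (hf' : HasDerivAt f' a 0)
    (hφ : ContDiffAt ℝ 2 φ 0) (hmax : IsLocalMax (fun t => f t - φ t) 0) :
    a ≤ iteratedDeriv 2 φ 0 := by
  by_contra! hlt
  have hφ1 : ∀ᶠ t in 𝓝 0, DifferentiableAt ℝ φ t :=
    (hφ.eventually (by simp)).mono fun t ht => ht.differentiableAt (by norm_num)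
  have hφ2 : DifferentiableAt ℝ (deriv φ) 0 := by
    have h1 : DifferentiableAt ℝ (fderiv ℝ φ) 0 :=
      (hφ.fderiv_right (m := 1) (by norm_num)).differentiableAt (by norm_num)
    exact h1.clm_apply (differentiableAt_const 1)
  have hd : deriv (fun t => f t - φ t) =ᶠ[𝓝 0] fun t => f' t - deriv φ t := by
    filter_upwards [hf, hφ1] with t h1 h2
    exact (h1.sub h2.hasDerivAt).deriv
  have hdd : deriv (deriv (fun t => f t - φ t)) 0 = a - iteratedDeriv 2 φ 0 := by
    rw [hd.deriv_eq, iteratedDeriv_succ, iteratedDeriv_one]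
    exact (hf'.sub hφ2.hasDerivAt).deriv
  -- A critical point with positive second derivative is a local minimum. Being a maximum too, it
  -- makes the difference locally constant, against the positive second derivative.
  have hmin : IsLocalMin (fun t => f t - φ t) 0 :=
    isLocalMin_of_deriv_deriv_pos (by rw [hdd]; linarith) hmax.deriv_eq_zero
      ((hf.self_of_nhds.sub hφ1.self_of_nhds.hasDerivAt).continuousAt)
  have hconst : (fun t => f t - φ t) =ᶠ[𝓝 0] fun _ => f 0 - φ 0 := by
    filter_upwards [hmax, hmin] with t h1 h2
    exact le_antisymm h1 h2
  have := hconst.deriv.deriv_eq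
  rw [hdd] at this
  simp at this
  linarith

theorem secondDeriv_ge_of_isLocalMin_sub {f f' φ : ℝ → ℝ} {a : ℝ}
    (hf : ∀ᶠ t in 𝓝 0, HasDerivAt f (f' t) t) (hf' : HasDerivAt f' a 0)
    (hφ : ContDiffAt ℝ 2 φ 0) (hmin : IsLocalMin (fun t => f t - φ t) 0) :
    iteratedDeriv 2 φ 0 ≤ a := by
  have h := secondDeriv_le_of_isLocalMax_sub (f := fun t => -f t) (f' := fun t => -f' t)
    (φ := fun t => -φ t) (a := -a) (hf.mono fun t ht => ht.neg) hf'.neg hφ.neg ?_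
  · have e : iteratedDeriv 2 (fun t => -φ t) 0 = -iteratedDeriv 2 φ 0 := by
      simp
    rw [e] at h; linarith
  · refine hmin.neg.congr (Eventually.of_forall fun t => ?_)
    simp only; ring

/-- No `C²` function touches `c |t|^(4/3)` from above at the origin. -/
theorem not_isLocalMax_abs_rpow_sub {φ : ℝ → ℝ} {c : ℝ} (hc : 0 < c) (hφ : ContDiffAt ℝ 2 φ 0) :
    ¬ IsLocalMax (fun t => c * |t| ^ (4 / 3 : ℝ) - φ t) 0 := by
  intro hmax
  -- Near 0 the parabola K t² lies below c |t|^(4/3), so φ would touch it from above as well,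
  -- forcing 2K ≤ φ''(0).
  set K : ℝ := |iteratedDeriv 2 φ 0| + 1 with hK
  have hK0 : 0 < K := by positivity
  have hcmp : ∀ᶠ t : ℝ in 𝓝 0, K * t ^ 2 ≤ c * |t| ^ (4 / 3 : ℝ) := by
    have h1 : Tendsto (fun t : ℝ => K * |t| ^ (2 / 3 : ℝ)) (𝓝 0) (𝓝 0) := by
      have : ContinuousAt (fun t : ℝ => K * |t| ^ (2 / 3 : ℝ)) 0 :=
        (continuous_const.mul (continuous_abs.rpow_const fun _ => Or.inr (by norm_num))).continuousAt
      simpa [ContinuousAt] using this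
    filter_upwards [h1.eventually (gt_mem_nhds hc)] with t ht
    rcases eq_or_ne t 0 with rfl | h0
    · simp
    have hp : 0 < |t| := abs_pos.mpr h0
    have e : t ^ 2 = |t| ^ (2 / 3 : ℝ) * |t| ^ (4 / 3 : ℝ) := by
      rw [← Real.rpow_add hp, ← sq_abs]; norm_num
    rw [e, ← mul_assoc]
    exact mul_le_mul_of_nonneg_right ht.le (by positivity)
  have h2 := secondDeriv_le_of_isLocalMax_sub (f := fun t => K * t ^ 2) (f' := fun t => K * (2 * t))
    (a := 2 * K) (φ := φ)
    (Eventually.of_forall fun t => by simpa using (hasDerivAt_pow 2 t).const_mul K)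
    (by simpa [mul_comm] using ((hasDerivAt_id (0 : ℝ)).const_mul (2 : ℝ)).const_mul K) hφ ?_
  · have := le_abs_self (iteratedDeriv 2 φ 0)
    linarith [abs_nonneg (iteratedDeriv 2 φ 0)]
  · filter_upwards [hmax, hcmp] with t h1 h2
    simp at h1 ⊢
    linarith

/-! ### Test functions along coordinate lines -/

section Lines

variable {n : ℕ} {u φ : EuclideanSpace ℝ (Fin n) → ℝ} {x₀ : EuclideanSpace ℝ (Fin n)}

theorem tendsto_line (x₀ : EuclideanSpace ℝ (Fin n)) (i : Fin n) :
    Tendsto (fun t : ℝ => x₀ + t • EuclideanSpace.single i (1 : ℝ)) (𝓝 0) (𝓝 x₀) := by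
  have : ContinuousAt (fun t : ℝ => x₀ + t • EuclideanSpace.single i (1 : ℝ)) 0 := by fun_prop
  simpa [ContinuousAt] using this

theorem contDiffAt_line (hφ : ContDiffAt ℝ 2 φ x₀) (i : Fin n) :
    ContDiffAt ℝ 2 (fun t : ℝ => φ (x₀ + t • EuclideanSpace.single i (1 : ℝ))) 0 := by
  refine ContDiffAt.comp (g := φ) (0 : ℝ) (by simpa using hφ) ?_
  fun_prop

theorem IsLocalMax.line (h : IsLocalMax u x₀) (i : Fin n) :
    IsLocalMax (fun t : ℝ => u (x₀ + t • EuclideanSpace.single i (1 : ℝ))) 0 := by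
  have := (tendsto_line x₀ i).eventually h
  filter_upwards [this] with t ht
  simpa using ht

theorem IsLocalMin.line (h : IsLocalMin u x₀) (i : Fin n) :
    IsLocalMin (fun t : ℝ => u (x₀ + t • EuclideanSpace.single i (1 : ℝ))) 0 := by
  have := (tendsto_line x₀ i).eventually h
  filter_upwards [this] with t ht
  simpa using ht

/-- `u` restricted to the `i`-th coordinate line through `x` is twice differentiable at `x`, with
second derivative `a`. -/
def HasSecondPartialAt (u : EuclideanSpace ℝ (Fin n) → ℝ) (i : Fin n) (a : ℝ)
    (x : EuclideanSpace ℝ (Fin n)) : Prop :=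
  ∃ f' : ℝ → ℝ, (∀ᶠ t in 𝓝 0,
    HasDerivAt (fun t : ℝ => u (x + t • EuclideanSpace.single i (1 : ℝ))) (f' t) t) ∧
    HasDerivAt f' a 0

theorem HasSecondPartialAt.secondPartial_eq {i : Fin n} {a : ℝ} (h : HasSecondPartialAt u i a x₀) :
    secondPartial u i x₀ = a := by
  obtain ⟨f', h1, h2⟩ := h
  have : deriv (fun t : ℝ => u (x₀ + t • EuclideanSpace.single i (1 : ℝ))) =ᶠ[𝓝 0] f' :=
    h1.mono fun t ht => ht.deriv
  rw [secondPartial, iteratedDeriv_succ, iteratedDeriv_one, this.deriv_eq, h2.deriv]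

theorem HasSecondPartialAt.le_secondPartial {i : Fin n} {a : ℝ} (h : HasSecondPartialAt u i a x₀)
    (hφ : ContDiffAt ℝ 2 φ x₀) (hmax : IsLocalMax (fun x => u x - φ x) x₀) :
    a ≤ secondPartial φ i x₀ := by
  obtain ⟨f', h1, h2⟩ := h
  exact secondDeriv_le_of_isLocalMax_sub h1 h2 (contDiffAt_line hφ i) (hmax.line i)

theorem HasSecondPartialAt.secondPartial_le {i : Fin n} {a : ℝ} (h : HasSecondPartialAt u i a x₀)
    (hφ : ContDiffAt ℝ 2 φ x₀) (hmin : IsLocalMin (fun x => u x - φ x) x₀) :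
    secondPartial φ i x₀ ≤ a := by
  obtain ⟨f', h1, h2⟩ := h
  exact secondDeriv_ge_of_isLocalMin_sub h1 h2 (contDiffAt_line hφ i) (hmin.line i)

/-- Touching gives an inequality on each coordinate line separately, and the product is monotone on
nonnegative entries. Only second differentiability along the coordinate lines through the point is
needed. -/
theorem one_le_coordinateOperator {a : Fin n → ℝ} (ha : ∀ i, HasSecondPartialAt u i (a i) x₀)
    (ha0 : ∀ i, 0 ≤ a i) (hprod : ∏ i, a i = 1) (hφ : ContDiffAt ℝ 2 φ x₀)
    (hmax : IsLocalMax (fun x => u x - φ x) x₀) :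
    (∀ i, 0 ≤ secondPartial φ i x₀) ∧ 1 ≤ coordinateOperator φ x₀ := by
  have h i := (ha i).le_secondPartial hφ hmax
  refine ⟨fun i => (ha0 i).trans (h i), Real.one_le_rpow ?_ (by positivity)⟩
  rw [← hprod]
  exact Finset.prod_le_prod (fun i _ => ha0 i) fun i _ => h i

theorem coordinateOperator_le_one {a : Fin n → ℝ} (ha : ∀ i, HasSecondPartialAt u i (a i) x₀)
    (hprod : ∏ i, a i = 1) (hφ : ContDiffAt ℝ 2 φ x₀)
    (hmin : IsLocalMin (fun x => u x - φ x) x₀) (h0 : ∀ i, 0 ≤ secondPartial φ i x₀) :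
    coordinateOperator φ x₀ ≤ 1 := by
  refine Real.rpow_le_one (Finset.prod_nonneg fun i _ => h0 i) ?_ (by positivity)
  rw [← hprod]
  exact Finset.prod_le_prod (fun i _ => h0 i) fun i _ => (ha i).secondPartial_le hφ hmin

/-- If `u` is twice differentiable with vanishing second derivative in one coordinate direction,
the supersolution inequality holds trivially. -/
theorem coordinateOperator_le_one_of_flat {i : Fin n} (ha : HasSecondPartialAt u i 0 x₀)
    (hφ : ContDiffAt ℝ 2 φ x₀) (hmin : IsLocalMin (fun x => u x - φ x) x₀)
    (h0 : ∀ i, 0 ≤ secondPartial φ i x₀) : coordinateOperator φ x₀ ≤ 1 := by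
  have h := le_antisymm (ha.secondPartial_le hφ hmin) (h0 i)
  rw [coordinateOperator, Finset.prod_eq_zero (Finset.mem_univ i) h]
  exact Real.zero_rpow_le_one _

/-- A function that behaves like `c |t|^(4/3)` on a coordinate line cannot be touched from above
by a `C²` function. -/
theorem not_isLocalMax_sub_of_line {i : Fin n} {c : ℝ} (hc : 0 < c)
    (hu : ∀ t : ℝ, u (x₀ + t • EuclideanSpace.single i (1 : ℝ)) = c * |t| ^ (4 / 3 : ℝ) + u x₀)
    (hφ : ContDiffAt ℝ 2 φ x₀) : ¬ IsLocalMax (fun x => u x - φ x) x₀ := by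
  intro hmax
  refine not_isLocalMax_abs_rpow_sub hc (contDiffAt_line hφ i) ?_
  have := hmax.line i
  filter_upwards [this] with t ht
  rw [hu] at ht
  simp at ht ⊢
  linarith

end Lines

/-! ### One-variable calculus and the factor h -/

theorem contDiff_two_of_hasDerivAt {f f' f'' : ℝ → ℝ} (h : ∀ x, HasDerivAt f (f' x) x)
    (h' : ∀ x, HasDerivAt f' (f'' x) x) (hc : Continuous f'') : ContDiff ℝ 2 f := by
  have e : deriv f = f' := funext fun x => (h x).deriv
  have e' : deriv f' = f'' := funext fun x => (h' x).deriv
  have : ContDiff ℝ (1 + 1) f := by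
    rw [contDiff_succ_iff_deriv]
    refine ⟨fun x => (h x).differentiableAt, by simp, ?_⟩
    rw [e, contDiff_one_iff_deriv, e']
    exact ⟨fun x => (h' x).differentiableAt, hc⟩
  exact this

theorem iteratedDeriv_two_of_hasDerivAt {f f' f'' : ℝ → ℝ} (h : ∀ x, HasDerivAt f (f' x) x)
    (h' : ∀ x, HasDerivAt f' (f'' x) x) : iteratedDeriv 2 f = f'' := by
  have e : deriv f = f' := funext fun x => (h x).deriv
  have e' : deriv f' = f'' := funext fun x => (h' x).deriv
  rw [iteratedDeriv_succ, iteratedDeriv_one, e, e']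

theorem convexOn_univ_of_hasDerivAt {f f' f'' : ℝ → ℝ} (h : ∀ x, HasDerivAt f (f' x) x)
    (h' : ∀ x, HasDerivAt f' (f'' x) x) (h0 : ∀ x, 0 ≤ f'' x) : ConvexOn ℝ univ f := by
  have e : deriv f = f' := funext fun x => (h x).deriv
  have e' : deriv f' = f'' := funext fun x => (h' x).deriv
  refine convexOn_univ_of_deriv2_nonneg (fun x => (h x).differentiableAt) ?_ ?_
  · rw [e]; exact fun x => (h' x).differentiableAt
  · simpa [e, e'] using h0

/-- The ODE `h² h'' = 1` has a global positive solution. -/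
theorem exists_sq_mul_secondDeriv_eq_one : ∃ h h' h'' : ℝ → ℝ, (∀ s, HasDerivAt h (h' s) s) ∧
    (∀ s, HasDerivAt h' (h'' s) s) ∧ Continuous h'' ∧ (∀ s, 0 < h s) ∧
    ∀ s, h s ^ 2 * h'' s = 1 := by
  -- the solution is `cosh² θ` in terms of the parameter `θ` with `√2 s = θ + sinh θ cosh θ`
  set σ : ℝ → ℝ := fun θ => (θ + Real.sinh θ * Real.cosh θ) / √2 with hσ
  have h2 : (0 : ℝ) < √2 := by positivity
  have hs2 : √2 * √2 = (2 : ℝ) := Real.mul_self_sqrt (by norm_num)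
  have hcosh θ := Real.cosh_pos θ
  have hcs θ := Real.cosh_sq θ
  have hd : ∀ θ, HasDerivAt σ (√2 * Real.cosh θ ^ 2) θ := by
    intro θ
    refine (((hasDerivAt_id θ).add ((Real.hasDerivAt_sinh θ).mul
      (Real.hasDerivAt_cosh θ))).div_const √2).congr_deriv ?_
    rw [div_eq_iff h2.ne', mul_right_comm, hs2]
    linear_combination -hcs θ
  have hσc : Continuous σ := by
    simp only [hσ]; fun_prop
  have hmono : StrictMono σ := strictMono_of_deriv_pos fun θ => by
    rw [(hd θ).deriv]; have := hcosh θ; positivity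
  have hge : ∀ θ, 0 ≤ θ → θ / √2 ≤ σ θ := fun θ h0 => by
    refine div_le_div_of_nonneg_right ?_ h2.le
    have := mul_nonneg (Real.sinh_nonneg_iff.mpr h0) (hcosh θ).le
    linarith
  have hle : ∀ θ, θ ≤ 0 → σ θ ≤ θ / √2 := fun θ h0 => by
    refine div_le_div_of_nonneg_right ?_ h2.le
    have := mul_nonpos_of_nonpos_of_nonneg (Real.sinh_nonpos_iff.mpr h0) (hcosh θ).le
    linarith
  have hsurj : Function.Surjective σ := hσc.surjective
    (tendsto_atTop_mono' _ ((eventually_ge_atTop 0).mono hge)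
      (tendsto_id.atTop_div_const h2))
    (tendsto_atBot_mono' _ ((eventually_le_atBot 0).mono hle)
      (tendsto_id.atBot_div_const h2))
  set e := hmono.orderIsoOfSurjective σ hsurj with he
  set θ : ℝ → ℝ := fun s => e.symm s with hθ
  have hθc : Continuous θ := e.symm.continuous
  have hinv : ∀ s, σ (θ s) = s := fun s => e.apply_symm_apply s
  have hθd : ∀ s, HasDerivAt θ (√2 * Real.cosh (θ s) ^ 2)⁻¹ s := fun s =>
    HasDerivAt.of_local_left_inverse hθc.continuousAt (hd (θ s))
      (by have := hcosh (θ s); positivity) (Eventually.of_forall hinv)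
  -- The first integral of h'' = h⁻² with h(0) = 1, h'(0) = 0 is h'²/2 + 1/h = 1; it becomes tanh² +
  -- 1/cosh² = 1 when h = cosh² θ.
  refine ⟨fun s => Real.cosh (θ s) ^ 2, fun s => √2 * (Real.sinh (θ s) / Real.cosh (θ s)),
    fun s => (Real.cosh (θ s) ^ 4)⁻¹, fun s => ?_, fun s => ?_, ?_, fun s => ?_, fun s => ?_⟩
  · have hc := (hcosh (θ s)).ne'
    refine (((Real.hasDerivAt_cosh (θ s)).comp s (hθd s)).pow 2).congr_deriv ?_
    simp only [Function.comp]
    field_simp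
    push_cast
    linear_combination -Real.cosh (θ s) * Real.sinh (θ s) * hs2
  · have hc := (hcosh (θ s)).ne'
    refine ((((Real.hasDerivAt_sinh (θ s)).div (Real.hasDerivAt_cosh (θ s)) hc).comp s
      (hθd s)).const_mul √2).congr_deriv ?_
    field_simp
    linear_combination hcs (θ s)
  · exact ((Real.continuous_cosh.comp hθc).pow 4).inv₀ fun s => (pow_pos (hcosh (θ s)) 4).ne'
  · have := hcosh (θ s); positivity
  · have := (hcosh (θ s)).ne'
    field_simp

/-! ### Bounded Lipschitz planar ODEs -/

/-- A time-dependent function on the plane that is bounded and Lipschitz, uniformly for times in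
`[0, T]`. -/
def UniformBddLipschitz (T : ℝ) (f : ℝ → ℝ × ℝ → ℝ) : Prop :=
  ∃ M K : ℝ, 0 ≤ M ∧ 0 ≤ K ∧ ∀ s ∈ Icc 0 T, ∀ y y', |f s y| ≤ M ∧ |f s y - f s y'| ≤ K * ‖y - y'‖

namespace UniformBddLipschitz

variable {T : ℝ} {f g : ℝ → ℝ × ℝ → ℝ}

theorem time {a : ℝ → ℝ} (ha : Continuous a) : UniformBddLipschitz T fun s _ => a s := by
  obtain ⟨M, hM⟩ := isCompact_Icc.exists_bound_of_continuousOn (ha.continuousOn (s := Icc 0 T))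
  refine ⟨|M|, 0, abs_nonneg _, le_rfl, fun s hs y y' => ⟨(hM s hs).trans (le_abs_self M), by simp⟩⟩

theorem clamp_fst (a b : ℝ) : UniformBddLipschitz T fun _ y => max a (min y.1 b) := by
  refine ⟨|a| + |b|, 1, by positivity, zero_le_one, fun s _ y y' => ⟨?_, ?_⟩⟩
  · rw [abs_le]
    have := neg_abs_le a; have := le_abs_self a; have := le_abs_self b; have := abs_nonneg b
    exact ⟨by linarith [le_max_left a (min y.1 b)], max_le (by linarith)
      ((min_le_right _ _).trans (by linarith [abs_nonneg a]))⟩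
  · rw [one_mul]
    have h1 := abs_max_sub_max_le_abs (min y.1 b) (min y'.1 b) a
    have h2 := abs_min_sub_min_le_max y.1 b y'.1 b
    have h3 : |y.1 - y'.1| ≤ ‖y - y'‖ := norm_fst_le (y - y')
    beta_reduce
    rw [max_comm a, max_comm a]
    rw [sub_self, abs_zero, max_eq_left (abs_nonneg _)] at h2
    exact h1.trans (h2.trans h3)

theorem clamp_snd (a b : ℝ) : UniformBddLipschitz T fun _ y => max a (min y.2 b) := by
  obtain ⟨M, K, hM, hK, h⟩ := clamp_fst (T := T) a b
  refine ⟨M, K, hM, hK, fun s hs y y' => ?_⟩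
  have := h s hs y.swap y'.swap
  simpa [Prod.norm_def, max_comm |y.2 - y'.2|] using this

theorem add (hf : UniformBddLipschitz T f) (hg : UniformBddLipschitz T g) :
    UniformBddLipschitz T fun s y => f s y + g s y := by
  obtain ⟨M, K, hM, hK, h⟩ := hf
  obtain ⟨M', K', hM', hK', h'⟩ := hg
  refine ⟨M + M', K + K', by positivity, by positivity, fun s hs y y' => ?_⟩
  obtain ⟨h1, h2⟩ := h s hs y y'
  obtain ⟨h3, h4⟩ := h' s hs y y'
  refine ⟨(abs_add_le _ _).trans (add_le_add h1 h3), ?_⟩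
  rw [add_sub_add_comm, add_mul]
  exact (abs_add_le _ _).trans (add_le_add h2 h4)

theorem mul (hf : UniformBddLipschitz T f) (hg : UniformBddLipschitz T g) :
    UniformBddLipschitz T fun s y => f s y * g s y := by
  obtain ⟨M, K, hM, hK, h⟩ := hf
  obtain ⟨M', K', hM', hK', h'⟩ := hg
  refine ⟨M * M', M * K' + K * M', by positivity, by positivity, fun s hs y y' => ?_⟩
  obtain ⟨h1, h2⟩ := h s hs y y'
  obtain ⟨-, h4⟩ := h' s hs y y'
  obtain ⟨h3, -⟩ := h' s hs y' y
  have h5 := (h' s hs y y').1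
  refine ⟨by rw [abs_mul]; gcongr, ?_⟩
  have e : f s y * g s y - f s y' * g s y' =
    f s y * (g s y - g s y') + (f s y - f s y') * g s y' := by ring
  rw [e]
  refine (abs_add_le _ _).trans ?_
  rw [abs_mul, abs_mul, add_mul, mul_assoc, mul_right_comm]
  gcongr

theorem max (hf : UniformBddLipschitz T f) (hg : UniformBddLipschitz T g) :
    UniformBddLipschitz T fun s y => Max.max (f s y) (g s y) := by
  obtain ⟨M, K, hM, hK, h⟩ := hf
  obtain ⟨M', K', hM', hK', h'⟩ := hg
  refine ⟨M + M', K + K', by positivity, by positivity, fun s hs y y' => ?_⟩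
  obtain ⟨h1, h2⟩ := h s hs y y'
  obtain ⟨h3, h4⟩ := h' s hs y y'
  refine ⟨abs_max_le_max_abs_abs.trans (max_le (by linarith) (by linarith)), ?_⟩
  refine (abs_max_sub_max_le_max _ _ _ _).trans (max_le (h2.trans ?_) (h4.trans ?_)) <;>
  gcongr <;> linarith

/-- The difference of the roots is the difference of the values over the sum of the roots, so a
positive lower bound on f keeps the Lipschitz constant finite. -/
theorem sqrt (hf : UniformBddLipschitz T f) {δ : ℝ} (hδ : 0 < δ)
    (h0 : ∀ s ∈ Icc 0 T, ∀ y, δ ^ 2 ≤ f s y) : UniformBddLipschitz T fun s y => √(f s y) := by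
  obtain ⟨M, K, hM, hK, h⟩ := hf
  refine ⟨√M, K / δ, by positivity, by positivity, fun s hs y y' => ?_⟩
  obtain ⟨h1, h2⟩ := h s hs y y'
  refine ⟨by rw [abs_of_nonneg (Real.sqrt_nonneg _)]
             exact Real.sqrt_le_sqrt ((le_abs_self _).trans h1), ?_⟩
  have ha := Real.le_sqrt_of_sq_le (h0 s hs y)
  have hb := Real.le_sqrt_of_sq_le (h0 s hs y')
  have ea := Real.sq_sqrt ((sq_nonneg δ).trans (h0 s hs y))
  have eb := Real.sq_sqrt ((sq_nonneg δ).trans (h0 s hs y'))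
  rw [div_mul_eq_mul_div, le_div_iff₀ hδ]
  refine le_trans ?_ h2
  have e : f s y - f s y' = (√(f s y) + √(f s y')) * (√(f s y) - √(f s y')) := by
    linear_combination eb - ea
  rw [e, abs_mul, mul_comm]
  gcongr
  rw [abs_of_nonneg (by linarith)]
  linarith

theorem const_div (hf : UniformBddLipschitz T f) {a δ : ℝ} (ha : 0 ≤ a) (hδ : 0 < δ)
    (h0 : ∀ s ∈ Icc 0 T, ∀ y, δ ≤ f s y) : UniformBddLipschitz T fun s y => a / f s y := by
  obtain ⟨M, K, hM, hK, h⟩ := hf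
  refine ⟨a / δ, a * K / (δ * δ), by positivity, by positivity, fun s hs y y' => ?_⟩
  obtain ⟨-, h2⟩ := h s hs y y'
  have h3 := h0 s hs y
  have h4 := h0 s hs y'
  have h5 := hδ.trans_le h3
  have h6 := hδ.trans_le h4
  beta_reduce
  refine ⟨by rw [abs_of_nonneg (by positivity)]; gcongr, ?_⟩
  have e : a / f s y - a / f s y' = -(a * (f s y - f s y')) / (f s y * f s y') := by
    field_simp; ring
  rw [e, abs_div, abs_neg, abs_mul, abs_of_nonneg ha, abs_of_pos (mul_pos h5 h6),
    div_mul_eq_mul_div, mul_assoc]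
  gcongr

end UniformBddLipschitz

/-- Global existence for a planar ODE with bounded Lipschitz right-hand side. -/
theorem exists_solution_of_uniformBddLipschitz {T : ℝ} (hT : 0 ≤ T) {f g : ℝ → ℝ × ℝ → ℝ}
    (hf : UniformBddLipschitz T f) (hg : UniformBddLipschitz T g)
    (hfc : ∀ y, ContinuousOn (f · y) (Icc 0 T)) (hgc : ∀ y, ContinuousOn (g · y) (Icc 0 T))
    (y₀ : ℝ × ℝ) : ∃ y : ℝ → ℝ × ℝ, y 0 = y₀ ∧ ∀ t ∈ Icc 0 T,
      HasDerivWithinAt y (f t (y t), g t (y t)) (Icc 0 T) t := by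
  obtain ⟨M, K, hM, hK, h⟩ := hf
  obtain ⟨M', K', hM', hK', h'⟩ := hg
  -- The speed is at most M + M', so a ball of radius (M + M') T cannot be left in time T and one
  -- application covers all of [0, T].
  have hpl : IsPicardLindelof (fun t y => (f t y, g t y)) (⟨0, left_mem_Icc.mpr hT⟩ : Icc 0 T) y₀
      ((M + M').toNNReal * T.toNNReal) 0 (M + M').toNNReal (K + K').toNNReal := by
    refine ⟨fun t ht => LipschitzOnWith.of_dist_le_mul fun y _ y' _ => ?_,
      fun y _ => (hfc y).prodMk (hgc y), fun t ht y _ => ?_, ?_⟩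
    · rw [dist_eq_norm, dist_eq_norm, Real.coe_toNNReal _ (by positivity)]
      refine norm_prod_le_iff.mpr ⟨(h t ht y y').2.trans ?_, (h' t ht y y').2.trans ?_⟩ <;>
      gcongr <;> linarith
    · rw [Real.coe_toNNReal _ (by positivity)]
      exact norm_prod_le_iff.mpr ⟨(h t ht y y).1.trans (by linarith),
        (h' t ht y y).1.trans (by linarith)⟩
    · simp [hT]
  obtain ⟨y, h0, hy⟩ := hpl.exists_eq_forall_mem_Icc_hasDerivWithinAt₀
  exact ⟨y, h0, hy⟩

/-! ### Shooting for the profile equation -/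

/-- The denominator `c + √(c² + 4 s² v)` in `v'' = 2 / (c + √(c² + 4 s² v))`, with
`c = v (4/9 v - 2/3 s v')` truncated from below, and `v`, `v'` truncated to a compact range. -/
noncomputable def profileDenom (s : ℝ) (y : ℝ × ℝ) : ℝ :=
  let v := max 1 (min y.1 145)
  let c := max (v * (4 / 9 * v + (-(2 / 3) * s) * max 0 (min y.2 36))) (max (4 / 9 - 2 * s) 0)
  c + √(c * c + 4 * s ^ 2 * v)

/-- As v ≥ 1, the root is at least 2s, which makes up exactly for the loss in c ≥ 4/9 - 2s. For the
last bound, c ≥ 2/9 when s ≤ 1/9, and 2s ≥ 2/9 otherwise. -/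
theorem le_add_sqrt {s v c : ℝ} (hs : 0 ≤ s) (hv : 1 ≤ v) (hc : max (4 / 9 - 2 * s) 0 ≤ c) :
    4 / 9 ≤ c + √(c * c + 4 * s ^ 2 * v) ∧ 2 * s ≤ c + √(c * c + 4 * s ^ 2 * v) ∧
      (2 / 9) ^ 2 ≤ c * c + 4 * s ^ 2 * v := by
  have hc0 : 0 ≤ c := (le_max_right _ _).trans hc
  have hc1 : 4 / 9 - 2 * s ≤ c := (le_max_left _ _).trans hc
  have h1 : (2 * s) ^ 2 ≤ c * c + 4 * s ^ 2 * v := by nlinarith [sq_nonneg s, mul_self_nonneg c]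
  have h2 := Real.le_sqrt_of_sq_le h1
  refine ⟨by linarith, by linarith, ?_⟩
  rcases le_total s (1 / 9) with h | h
  · nlinarith [sq_nonneg s]
  · nlinarith [mul_self_nonneg c]

theorem profileDenom_bounds {s : ℝ} (hs : 0 ≤ s) (y : ℝ × ℝ) :
    4 / 9 ≤ profileDenom s y ∧ 2 * s ≤ profileDenom s y :=
  have h := le_add_sqrt hs (le_max_left 1 (min y.1 145)) (le_max_right _ _)
  ⟨h.1, h.2.1⟩

theorem profileDenom_lipschitz : UniformBddLipschitz 8 profileDenom := by
  have hv := UniformBddLipschitz.clamp_fst (T := 8) 1 145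
  have hu := UniformBddLipschitz.clamp_snd (T := 8) 0 36
  have hc := (hv.mul (((UniformBddLipschitz.time continuous_const (a := fun _ => 4 / 9)).mul
    hv).add ((UniformBddLipschitz.time (a := fun s => -(2 / 3) * s) (by fun_prop)).mul hu))).max
    (UniformBddLipschitz.time (a := fun s => max (4 / 9 - 2 * s) 0) (by fun_prop))
  refine hc.add (((hc.mul hc).add
    ((UniformBddLipschitz.time (a := fun s => 4 * s ^ 2) (by fun_prop)).mul hv)).sqrt
    (δ := 2 / 9) (by norm_num) fun s hs y => ?_)
  exact (le_add_sqrt hs.1 (le_max_left 1 (min y.1 145)) (le_max_right _ _)).2.2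

theorem continuous_profileDenom (y : ℝ × ℝ) : Continuous (profileDenom · y) := by
  unfold profileDenom
  fun_prop

/-- The equation is quadratic in v''; its positive root in the rationalized form 2 / (c + √(c² + 4
s² v)) has no singularity at s = 0. The clamps come from v'' ≤ 2 / (4/9) = 9/2, which on [0, 8]
gives v' ≤ 36 and v ≤ 1 + 9/4 · 64 = 145. -/
theorem exists_truncated_profile : ∃ v v' : ℝ → ℝ, v 0 = 1 ∧ v' 0 = 0 ∧
    (∀ t ∈ Icc (0 : ℝ) 8, HasDerivWithinAt v (max 0 (min (v' t) 36)) (Icc 0 8) t) ∧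
    ∀ t ∈ Icc (0 : ℝ) 8, HasDerivWithinAt v' (2 / profileDenom t (v t, v' t)) (Icc 0 8) t := by
  obtain ⟨y, h0, hy⟩ := exists_solution_of_uniformBddLipschitz (T := 8) (by norm_num)
    (UniformBddLipschitz.clamp_snd 0 36)
    (profileDenom_lipschitz.const_div (a := 2) (δ := 4 / 9) (by norm_num) (by norm_num)
      fun s hs y => (profileDenom_bounds hs.1 y).1)
    (fun y => continuousOn_const)
    (fun y => continuousOn_const.div (continuous_profileDenom y).continuousOn fun s hs => by
      have := (profileDenom_bounds hs.1 y).1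
      exact (by linarith : 0 < profileDenom s y).ne') (1, 0)
  exact ⟨fun t => (y t).1, fun t => (y t).2, by simp [h0], by simp [h0],
    fun t ht => (hy t ht).fst, fun t ht => (hy t ht).snd⟩

/-- Comparison of functions through their derivatives on an interval. -/
theorem le_of_hasDerivWithinAt_le {f f' g g' : ℝ → ℝ} {a b : ℝ}
    (hf : ∀ t ∈ Icc a b, HasDerivWithinAt f (f' t) (Icc a b) t)
    (hg : ∀ t ∈ Icc a b, HasDerivWithinAt g (g' t) (Icc a b) t)
    (h : ∀ t ∈ Icc a b, f' t ≤ g' t) (ha : f a ≤ g a) {t : ℝ} (ht : t ∈ Icc a b) : f t ≤ g t := by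
  have hm : MonotoneOn (fun t => g t - f t) (Icc a b) :=
    monotoneOn_of_hasDerivWithinAt_nonneg (f' := fun t => g' t - f' t) (convex_Icc a b)
      (fun t ht => ((hg t ht).sub (hf t ht)).continuousWithinAt)
      (fun t ht => (((hg t (interior_subset ht)).sub (hf t (interior_subset ht))).mono
        interior_subset)) fun t ht => sub_nonneg.mpr (h t (interior_subset ht))
  have := hm (left_mem_Icc.mpr (ht.1.trans ht.2)) ht ht.1
  simp only at this
  linarith

theorem hasDerivWithinAt_affine (a b : ℝ) (s : Set ℝ) (t : ℝ) :
    HasDerivWithinAt (fun t => a + b * t) b s t := by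
  simpa using (((hasDerivAt_id t).const_mul b).const_add a).hasDerivWithinAt

/-- A solution of `v v'' (4/9 v - 2/3 s v' + s² v'') = 1` with `v' (0) = 0`, on an interval `[0, S]`
at whose right end `s v' / v = 2 / 3`. -/
theorem exists_profile_on_interval : ∃ (S : ℝ) (v v' v'' : ℝ → ℝ), 0 < S ∧ v' 0 = 0 ∧
    (∀ t ∈ Icc 0 S, HasDerivWithinAt v (v' t) (Icc 0 S) t) ∧
    (∀ t ∈ Icc 0 S, HasDerivWithinAt v' (v'' t) (Icc 0 S) t) ∧ ContinuousOn v'' (Icc 0 S) ∧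
    (∀ t ∈ Icc 0 S, 0 < v t ∧ 0 < v'' t ∧
      v t * v'' t * (4 / 9 * v t - 2 / 3 * (t * v' t) + t ^ 2 * v'' t) = 1) ∧
    S * v' S = 2 / 3 * v S := by
  obtain ⟨v, u, hv0, hu0, hv, hu⟩ := exists_truncated_profile
  set N : ℝ → ℝ := fun t => profileDenom t (v t, u t) with hN
  have hN1 : ∀ t ∈ Icc (0 : ℝ) 8, 4 / 9 ≤ N t := fun t ht => (profileDenom_bounds ht.1 _).1
  have hN2 : ∀ t ∈ Icc (0 : ℝ) 8, 2 * t ≤ N t := fun t ht => (profileDenom_bounds ht.1 _).2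
  have hNpos : ∀ t ∈ Icc (0 : ℝ) 8, 0 < N t := fun t ht => by linarith [hN1 t ht]
  have hvc : ContinuousOn v (Icc 0 8) := fun t ht => (hv t ht).continuousWithinAt
  have huc : ContinuousOn u (Icc 0 8) := fun t ht => (hu t ht).continuousWithinAt
  have hNc : ContinuousOn N (Icc 0 8) := by
    simp only [hN, profileDenom]
    fun_prop
  -- the truncations are inactive
  have hub : ∀ t ∈ Icc (0 : ℝ) 8, u t ≤ 0 + 9 / 2 * t := fun t ht =>
    le_of_hasDerivWithinAt_le hu (fun t _ => hasDerivWithinAt_affine 0 (9 / 2) _ t)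
      (fun t ht => by
        rw [div_le_iff₀ (hNpos t ht)]; linarith [hN1 t ht]) (by simp [hu0]) ht
  have hu_nonneg : ∀ t ∈ Icc (0 : ℝ) 8, 0 ≤ u t := fun t ht =>
    le_of_hasDerivWithinAt_le (fun t _ => hasDerivWithinAt_const t _ 0) hu
      (fun t ht => (div_pos two_pos (hNpos t ht)).le) (by simp [hu0]) ht
  have hclu : ∀ t ∈ Icc (0 : ℝ) 8, max 0 (min (u t) 36) = u t := fun t ht => by
    rw [min_eq_left (by linarith [hub t ht, ht.2]), max_eq_right (hu_nonneg t ht)]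
  have hv' : ∀ t ∈ Icc (0 : ℝ) 8, HasDerivWithinAt v (u t) (Icc 0 8) t := fun t ht => by
    have := hv t ht
    rwa [hclu t ht] at this
  have hv1 : ∀ t ∈ Icc (0 : ℝ) 8, 1 ≤ v t := fun t ht =>
    le_of_hasDerivWithinAt_le (fun t _ => hasDerivWithinAt_const t _ 1) hv' hu_nonneg hv0.ge ht
  have hvb : ∀ t ∈ Icc (0 : ℝ) 8, v t ≤ 1 + 9 / 4 * t ^ 2 := fun t ht => by
    refine le_of_hasDerivWithinAt_le hv' (g := fun t => 1 + 9 / 4 * t ^ 2)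
      (g' := fun t => 9 / 4 * (2 * t)) (fun t _ => ?_) (fun t ht => ?_) (by simp [hv0]) ht
    · simpa using (((hasDerivAt_pow 2 t).const_mul (9 / 4)).const_add 1).hasDerivWithinAt
    · linarith [hub t ht]
  have hclv : ∀ t ∈ Icc (0 : ℝ) 8, max 1 (min (v t) 145) = v t := fun t ht => by
    rw [min_eq_left (by nlinarith [hvb t ht, ht.2, ht.1]), max_eq_right (hv1 t ht)]
  -- A zero of B is the wanted end condition, and B decreases. While B ≥ 0 the truncation of c = v B
  -- has to be shown inactive.
  set B : ℝ → ℝ := fun t => 4 / 9 * v t - 2 / 3 * (t * u t) with hB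
  have hBd : ∀ t ∈ Icc (0 : ℝ) 8,
      HasDerivWithinAt B (-(2 / 9) * u t - 2 / 3 * (t * (2 / N t))) (Icc 0 8) t := fun t ht => by
    refine (((hv' t ht).const_mul (4 / 9)).sub (((hasDerivWithinAt_id t _).mul
      (hu t ht)).const_mul (2 / 3))).congr_deriv ?_
    simp only [id, hN]; ring
  have htN : ∀ t ∈ Icc (0 : ℝ) 8, t * (2 / N t) ≤ 1 := fun t ht => by
    rw [← mul_div_assoc, div_le_iff₀ (hNpos t ht)]; linarith [hN2 t ht]
  have htN0 : ∀ t ∈ Icc (0 : ℝ) 8, 0 ≤ t * (2 / N t) := fun t ht =>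
    mul_nonneg ht.1 (div_pos two_pos (hNpos t ht)).le
  have hB0 : B 0 = 4 / 9 := by simp [hB, hv0]
  -- At t = 2/9 the floor 4/9 - 2t reaches 0. Before that u ≤ 1 and t v'' ≤ 1, so B' ≥ -8/9 ≥ -2 and
  -- B stays above the floor.
  have hBlow : ∀ t ∈ Icc (0 : ℝ) (2 / 9), 4 / 9 + -2 * t ≤ B t := fun t ht => by
    have hsub : Icc (0 : ℝ) (2 / 9) ⊆ Icc 0 8 := Icc_subset_Icc_right (by norm_num)
    refine le_of_hasDerivWithinAt_le (fun t _ => hasDerivWithinAt_affine _ _ _ t)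
      (fun t ht => (hBd t (hsub ht)).mono hsub) (fun t ht => ?_) (by simp [hB0]) ht
    linarith [hub t (hsub ht), htN t (hsub ht), ht.2]
  have hNeq : ∀ t ∈ Icc (0 : ℝ) 8, N t = max (v t * B t) (max (4 / 9 - 2 * t) 0) +
      √(max (v t * B t) (max (4 / 9 - 2 * t) 0) * max (v t * B t) (max (4 / 9 - 2 * t) 0) +
        4 * t ^ 2 * v t) := fun t ht => by
    have e : 4 / 9 * v t + -(2 / 3) * t * u t = B t := by simp only [hB]; ring
    simp only [hN, profileDenom, hclv t ht, hclu t ht, e]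
  have hBup : ∀ t ∈ Icc (0 : ℝ) 8, B t ≤ 4 / 9 := fun t ht => by
    refine le_of_hasDerivWithinAt_le hBd (fun t _ => hasDerivWithinAt_const t _ (4 / 9))
      (fun t ht => ?_) hB0.le ht
    linarith [hu_nonneg t ht, htN0 t ht]
  -- `v'` is bounded below, so that `B` becomes negative
  have hsub1 : Icc (0 : ℝ) 1 ⊆ Icc 0 8 := Icc_subset_Icc_right (by norm_num)
  -- On [0, 1], c ≤ 13/4 · 4/9 ≤ 3/2 and the root is at most 9/2. Hence v'' ≥ 1/3 there, and v' ≥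
  -- 1/3 from t = 1 on.
  have hNup : ∀ t ∈ Icc (0 : ℝ) 1, N t ≤ 6 := fun t ht => by
    have h1 := hvb t (hsub1 ht)
    have h2 := hv1 t (hsub1 ht)
    have h3 := hBup t (hsub1 ht)
    have hv4 : v t ≤ 13 / 4 := by nlinarith [ht.1, ht.2]
    rw [hNeq t (hsub1 ht)]
    have hc : max (v t * B t) (max (4 / 9 - 2 * t) 0) ≤ 3 / 2 :=
      max_le (by nlinarith) (max_le (by linarith [ht.1]) (by norm_num))
    have hc0 : 0 ≤ max (v t * B t) (max (4 / 9 - 2 * t) 0) :=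
      (le_max_right _ _).trans (le_max_right _ _)
    generalize max (v t * B t) (max (4 / 9 - 2 * t) 0) = c at hc hc0
    have ht2 : t ^ 2 ≤ 1 := by nlinarith [ht.1, ht.2]
    have : √(c * c + 4 * t ^ 2 * v t) ≤ 9 / 2 := by
      rw [Real.sqrt_le_left (by norm_num)]
      nlinarith
    linarith
  have hu1 : 1 / 3 ≤ u 1 := by
    have := le_of_hasDerivWithinAt_le (t := 1) (fun t _ => hasDerivWithinAt_affine 0 (1 / 3) _ t)
      (fun t ht => (hu t (hsub1 ht)).mono hsub1) (fun t ht => by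
        rw [le_div_iff₀ (hNpos t (hsub1 ht))]
        linarith [hNup t ht]) (by simp [hu0]) (right_mem_Icc.mpr zero_le_one)
    linarith
  have hsub8 : Icc (1 : ℝ) 8 ⊆ Icc 0 8 := Icc_subset_Icc_left (by norm_num)
  have hu8 : ∀ t ∈ Icc (1 : ℝ) 8, 1 / 3 ≤ u t := fun t ht =>
    le_of_hasDerivWithinAt_le (fun t _ => hasDerivWithinAt_const t _ (1 / 3))
      (fun t ht => (hu t (hsub8 ht)).mono hsub8)
      (fun t ht => (div_pos two_pos (hNpos t (hsub8 ht))).le) hu1 ht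
  -- On [1, 8], B' ≤ -(2/9)(1/3) = -2/27, so B(8) ≤ 4/9 - 14/27 < 0. This is why the interval has
  -- length 8.
  have hB8 : B 8 < 0 := by
    have := le_of_hasDerivWithinAt_le (t := 8) (fun t ht => (hBd t (hsub8 ht)).mono hsub8)
      (fun t _ => hasDerivWithinAt_affine (4 / 9 + 2 / 27) (-(2 / 27)) _ t)
      (fun t ht => by linarith [hu8 t ht, htN0 t (hsub8 ht)])
      (by linarith [hBup 1 (by norm_num)]) (right_mem_Icc.mpr (by norm_num))
    linarith
  -- `S` is a zero of `B`
  have hBc : ContinuousOn B (Icc 0 8) := fun t ht => (hBd t ht).continuousWithinAt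
  obtain ⟨S, hS, hBS⟩ := intermediate_value_Icc' (by norm_num) hBc
    (show (0 : ℝ) ∈ Icc (B 8) (B 0) from ⟨hB8.le, by rw [hB0]; norm_num⟩)
  have hS0 : 0 < S := hS.1.lt_of_ne fun h => by
    rw [← h, hB0] at hBS; norm_num at hBS
  have hsubS : Icc 0 S ⊆ Icc 0 8 := Icc_subset_Icc_right hS.2
  have hanti : AntitoneOn B (Icc 0 8) :=
    antitoneOn_of_hasDerivWithinAt_nonpos (convex_Icc 0 8) hBc
      (fun t ht => (hBd t (interior_subset ht)).mono interior_subset) fun t ht => by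
        linarith [hu_nonneg t (interior_subset ht), htN0 t (interior_subset ht)]
  have hBnn : ∀ t ∈ Icc 0 S, 0 ≤ B t := fun t ht => hBS ▸ hanti (hsubS ht) hS ht.2
  refine ⟨S, v, u, fun t => 2 / N t, hS0, hu0, fun t ht => (hv' t (hsubS ht)).mono hsubS,
    fun t ht => (hu t (hsubS ht)).mono hsubS,
    continuousOn_const.div (hNc.mono hsubS) fun t ht => (hNpos t (hsubS ht)).ne', fun t ht => ?_, ?_⟩
  · have h1 := hv1 t (hsubS ht)
    have hp := hNpos t (hsubS ht)
    refine ⟨by linarith, div_pos two_pos hp, ?_⟩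
    have hc : max (v t * B t) (max (4 / 9 - 2 * t) 0) = v t * B t := by
      refine max_eq_left (max_le ?_ (mul_nonneg (by linarith) (hBnn t ht)))
      rcases le_total t (2 / 9) with h | h
      · nlinarith [hBlow t ⟨ht.1, h⟩, hBnn t ht]
      · nlinarith [hBnn t ht]
    have hN' := hNeq t (hsubS ht)
    rw [hc] at hN'
    have hsq := Real.sq_sqrt (show 0 ≤ v t * B t * (v t * B t) + 4 * t ^ 2 * v t by
      nlinarith [mul_self_nonneg (v t * B t), mul_nonneg (sq_nonneg t) (by linarith : 0 ≤ v t)])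
    rw [← sub_eq_iff_eq_add'.mpr hN'] at hsq
    change v t * (2 / N t) * (B t + t ^ 2 * (2 / N t)) = 1
    field_simp
    linear_combination -hsq
  · simp only [hB] at hBS
    linarith

/-- Replacing v by k v(S t) multiplies the left side of the equation by k³ S² and preserves the end
conditions, so k = S^(-2/3) moves S to 1. -/
theorem exists_normalized_profile : ∃ g g' g'' : ℝ → ℝ, Continuous g ∧ Continuous g' ∧
    Continuous g'' ∧ (∀ t ∈ Ioo (0 : ℝ) 1, HasDerivAt g (g' t) t) ∧
    (∀ t ∈ Ioo (0 : ℝ) 1, HasDerivAt g' (g'' t) t) ∧ g' 0 = 0 ∧ g' 1 = 2 / 3 * g 1 ∧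
    ∀ t ∈ Icc (0 : ℝ) 1, 0 < g t ∧ 0 < g'' t ∧
      g t * g'' t * (4 / 9 * g t - 2 / 3 * (t * g' t) + t ^ 2 * g'' t) = 1 := by
  obtain ⟨S, v, v', v'', hS, h0, hv, hv', hc, heq, hend⟩ := exists_profile_on_interval
  set k : ℝ := S ^ (-(2 / 3) : ℝ) with hk
  have hk0 : 0 < k := Real.rpow_pos_of_pos hS _
  have hk3 : k ^ 3 * S ^ 2 = 1 := by
    rw [hk, ← Real.rpow_natCast, ← Real.rpow_mul hS.le, ← Real.rpow_natCast, ← Real.rpow_add hS]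
    norm_num
  -- Clamping makes all three functions continuous on ℝ; derivatives are claimed only inside (0, 1),
  -- since the endpoints are recovered after gluing.
  set p : ℝ → ℝ := fun t => S * max 0 (min t 1) with hp
  have hpc : Continuous p := by fun_prop
  have hpS : ∀ t, p t ∈ Icc 0 S := fun t => by
    refine ⟨mul_nonneg hS.le (le_max_left _ _), ?_⟩
    calc S * max 0 (min t 1) ≤ S * 1 := by
          gcongr; exact max_le zero_le_one (min_le_right _ _)
      _ = S := mul_one S
  have hpt : ∀ t ∈ Icc (0 : ℝ) 1, p t = S * t := fun t ht => by
    simp only [hp]; rw [min_eq_left ht.2, max_eq_right ht.1]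
  have hpd : ∀ t ∈ Ioo (0 : ℝ) 1, HasDerivAt p S t := fun t ht => by
    refine HasDerivAt.congr_of_eventuallyEq (f := fun t => S * t)
      (by simpa using (hasDerivAt_id t).const_mul S) ?_
    filter_upwards [Ioo_mem_nhds ht.1 ht.2] with x hx
    exact hpt x (Ioo_subset_Icc_self hx)
  have hcomp : ∀ f f' : ℝ → ℝ, (∀ t ∈ Icc 0 S, HasDerivWithinAt f (f' t) (Icc 0 S) t) →
      ∀ t ∈ Ioo (0 : ℝ) 1, HasDerivAt (fun t => f (p t)) (S * f' (p t)) t := fun f f' hf t ht => by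
    have h1 : p t ∈ Ioo 0 S := by
      rw [hpt t (Ioo_subset_Icc_self ht)]
      exact ⟨mul_pos hS ht.1, by nlinarith [ht.2]⟩
    have := (hf (p t) (hpS t)).hasDerivAt (Icc_mem_nhds h1.1 h1.2)
    exact (this.comp t (hpd t ht)).congr_deriv (mul_comm _ _)
  have hcont : ∀ f : ℝ → ℝ, ContinuousOn f (Icc 0 S) → Continuous fun t => f (p t) :=
    fun f hf => hf.comp_continuous hpc hpS
  refine ⟨fun t => k * v (p t), fun t => k * S * v' (p t), fun t => k * S ^ 2 * v'' (p t),
    continuous_const.mul (hcont v fun t ht => (hv t ht).continuousWithinAt),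
    continuous_const.mul (hcont v' fun t ht => (hv' t ht).continuousWithinAt),
    continuous_const.mul (hcont v'' hc), fun t ht => ?_, fun t ht => ?_, ?_, ?_, fun t ht => ?_⟩
  · exact ((hcomp v v' hv t ht).const_mul k).congr_deriv (by ring)
  · exact ((hcomp v' v'' hv' t ht).const_mul (k * S)).congr_deriv (by ring)
  · beta_reduce; rw [hpt 0 (by simp), mul_zero, h0, mul_zero]
  · beta_reduce; rw [hpt 1 (by simp), mul_one]; linear_combination k * hend
  · obtain ⟨h1, h2, h3⟩ := heq (p t) (hpS t)
    refine ⟨by positivity, by positivity, ?_⟩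
    beta_reduce
    rw [hpt t ht] at h3 ⊢
    linear_combination k ^ 3 * S ^ 2 * h3 + hk3

/-! ### Gluing the profile by inversion and reflection -/

/-- A continuous function with derivative `f'` off a countable set, where `f'` is continuous, has
derivative `f'` everywhere. -/
theorem hasDerivAt_of_off_countable {f f' : ℝ → ℝ} {s : Set ℝ} (hs : s.Countable)
    (hf : Continuous f) (hf' : Continuous f') (h : ∀ x ∉ s, HasDerivAt f (f' x) x) (x : ℝ) :
    HasDerivAt f (f' x) x := by
  have e : f = fun y => f 0 + ∫ t in (0 : ℝ)..y, f' t := by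
    funext y
    rw [MeasureTheory.integral_eq_of_hasDerivAt_off_countable f f' hs hf.continuousOn
      (fun x hx => h x hx.2) (hf'.intervalIntegrable _ _)]
    ring
  rw [e]
  exact (intervalIntegral.integral_hasDerivAt_right (hf'.intervalIntegrable _ _)
    (hf'.stronglyMeasurableAtFilter _ _) hf'.continuousAt).const_add _

/-- `V` is the restriction to `y = 1` of a positive solution of `w w₁₁ w₂₂ = 1` that is homogeneous
of degree `4/3`, even in each variable and symmetric under exchange of the variables;
`V'` and `V''` are its derivatives. -/
structure IsProfile (V V' V'' : ℝ → ℝ) : Prop where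
  hasDerivAt : ∀ s, HasDerivAt V (V' s) s
  hasDerivAt' : ∀ s, HasDerivAt V' (V'' s) s
  continuous : Continuous V''
  pos : ∀ s, 0 < V s
  pos' : ∀ s, 0 < V'' s
  equation : ∀ s, V s * V'' s * (4 / 9 * V s - 2 / 3 * (s * V' s) + s ^ 2 * V'' s) = 1
  even : ∀ s, V (-s) = V s
  inversion : ∀ s, s ≠ 0 → V s = |s| ^ (4 / 3 : ℝ) * V s⁻¹

/-- Inversion s ↦ 1/s is the exchange of the two variables, so it preserves the equation. At s = 1
the first derivatives match because g'(1) = 2/3 g(1), and then so do the second; at s = 0 evenness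
is compatible with g'(0) = 0. -/
theorem exists_isProfile : ∃ V V' V'' : ℝ → ℝ, IsProfile V V' V'' := by
  obtain ⟨g, g', g'', hgc, hgc', hgc'', hg, hg', h0, h1, heq⟩ := exists_normalized_profile
  -- extension to `[1, ∞)` by inversion
  set P : ℝ → ℝ := fun s => if s ≤ 1 then g s else
    (max s 1) ^ (4 / 3 : ℝ) * g (max s 1)⁻¹ with hP
  set P' : ℝ → ℝ := fun s => if s ≤ 1 then g' s else
    4 / 3 * (max s 1) ^ (1 / 3 : ℝ) * g (max s 1)⁻¹ -
      (max s 1) ^ (-(2 / 3) : ℝ) * g' (max s 1)⁻¹ with hP'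
  set P'' : ℝ → ℝ := fun s => if s ≤ 1 then g'' s else
    (max s 1) ^ (-(2 / 3) : ℝ) * (4 / 9 * g (max s 1)⁻¹ -
      2 / 3 * ((max s 1)⁻¹ * g' (max s 1)⁻¹) + (max s 1)⁻¹ ^ 2 * g'' (max s 1)⁻¹) with hP''
  have hmc : Continuous fun s : ℝ => max s 1 := by fun_prop
  have hm0 : ∀ s : ℝ, max s 1 ≠ 0 := fun s => (zero_lt_one.trans_le (le_max_right s 1)).ne'
  have hmi : Continuous fun s : ℝ => (max s 1)⁻¹ := hmc.inv₀ hm0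
  have hmr : ∀ a : ℝ, Continuous fun s : ℝ => (max s 1) ^ a := fun a =>
    hmc.rpow_const fun s => Or.inl (hm0 s)
  have hPc : Continuous P := by
    refine Continuous.if_le hgc ((hmr _).mul (hgc.comp hmi)) continuous_id continuous_const ?_
    rintro s rfl; simp
  have hPc' : Continuous P' := by
    refine Continuous.if_le hgc' (((continuous_const.mul (hmr _)).mul (hgc.comp hmi)).sub
      ((hmr _).mul (hgc'.comp hmi))) continuous_id continuous_const ?_
    rintro s rfl; simp; linarith
  have hPc'' : Continuous P'' := by
    refine Continuous.if_le hgc'' ((hmr _).mul (((continuous_const.mul (hgc.comp hmi)).sub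
      (continuous_const.mul (hmi.mul (hgc'.comp hmi)))).add ((hmi.pow 2).mul (hgc''.comp hmi))))
      continuous_id continuous_const ?_
    rintro s rfl; simp; linarith
  have hinv : ∀ s : ℝ, 1 < s → s⁻¹ ∈ Ioo (0 : ℝ) 1 := fun s hs =>
    ⟨by positivity, inv_lt_one_of_one_lt₀ hs⟩
  have hrp : ∀ s : ℝ, 1 < s → s ^ (4 / 3 : ℝ) = s * s ^ (1 / 3 : ℝ) ∧
      s ^ (-(2 / 3) : ℝ) = s⁻¹ * s ^ (1 / 3 : ℝ) ∧ (s ^ (1 / 3 : ℝ)) ^ 3 = s := fun s hs => by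
    have h0 : 0 < s := by linarith
    refine ⟨?_, ?_, ?_⟩
    · nth_rw 2 [← Real.rpow_one s]
      rw [← Real.rpow_add h0]; norm_num
    · rw [← Real.rpow_neg_one, ← Real.rpow_add h0]; norm_num
    · rw [← Real.rpow_natCast, ← Real.rpow_mul h0.le]; norm_num
  have hcomp : ∀ f f' : ℝ → ℝ, (∀ t ∈ Ioo (0 : ℝ) 1, HasDerivAt f (f' t) t) → ∀ s : ℝ, 1 < s →
      HasDerivAt (fun s => f s⁻¹) (-(s ^ 2)⁻¹ * f' s⁻¹) s := fun f f' hf s hs => by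
    have := (hf _ (hinv s hs)).comp s (hasDerivAt_inv (by linarith : s ≠ 0))
    exact this.congr_deriv (mul_comm _ _)
  have hPd : ∀ s, 0 < s → s ≠ 1 → HasDerivAt P (P' s) s := fun s hs0 hs1 => by
    rcases lt_or_gt_of_ne hs1 with hs | hs
    · have : P' s = g' s := if_pos hs.le
      rw [this]
      refine (hg s ⟨hs0, hs⟩).congr_of_eventuallyEq ?_
      filter_upwards [Iio_mem_nhds hs] with x hx using if_pos (le_of_lt hx)
    · have e : P =ᶠ[𝓝 s] fun s => s ^ (4 / 3 : ℝ) * g s⁻¹ := by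
        filter_upwards [Ioi_mem_nhds hs] with x hx
        simp only [hP]
        rw [if_neg (not_le.mpr hx), max_eq_left (le_of_lt hx)]
      refine HasDerivAt.congr_of_eventuallyEq ?_ e
      refine ((Real.hasDerivAt_rpow_const (Or.inl hs0.ne')).mul (hcomp g g' hg s hs)).congr_deriv ?_
      simp only [hP']
      rw [if_neg (not_le.mpr hs), max_eq_left hs.le]
      norm_num
      obtain ⟨e1, e2, -⟩ := hrp s hs
      rw [e1]
      norm_num at e2
      rw [e2]
      field_simp
      try ring
  have hPd' : ∀ s, 0 < s → s ≠ 1 → HasDerivAt P' (P'' s) s := fun s hs0 hs1 => by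
    rcases lt_or_gt_of_ne hs1 with hs | hs
    · have : P'' s = g'' s := if_pos hs.le
      rw [this]
      refine (hg' s ⟨hs0, hs⟩).congr_of_eventuallyEq ?_
      filter_upwards [Iio_mem_nhds hs] with x hx using if_pos (le_of_lt hx)
    · have e : P' =ᶠ[𝓝 s] fun s => 4 / 3 * s ^ (1 / 3 : ℝ) * g s⁻¹ -
          s ^ (-(2 / 3) : ℝ) * g' s⁻¹ := by
        filter_upwards [Ioi_mem_nhds hs] with x hx
        simp only [hP']
        rw [if_neg (not_le.mpr hx), max_eq_left (le_of_lt hx)]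
      refine HasDerivAt.congr_of_eventuallyEq ?_ e
      refine ((((Real.hasDerivAt_rpow_const (Or.inl hs0.ne')).const_mul (4 / 3)).mul
        (hcomp g g' hg s hs)).sub ((Real.hasDerivAt_rpow_const (Or.inl hs0.ne')).mul
        (hcomp g' g'' hg' s hs))).congr_deriv ?_
      simp only [hP'']
      rw [if_neg (not_le.mpr hs), max_eq_left hs.le]
      obtain ⟨e1, e2, -⟩ := hrp s hs
      have e3 : s ^ (1 / 3 - 1 : ℝ) = s⁻¹ * s ^ (1 / 3 : ℝ) := by
        rw [← e2]; norm_num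
      have e4 : s ^ (-(2 / 3) - 1 : ℝ) = s⁻¹ * s⁻¹ * s ^ (1 / 3 : ℝ) := by
        rw [mul_assoc, ← e2, ← Real.rpow_neg_one, ← Real.rpow_add hs0]; norm_num
      rw [e4, e3, e2]
      field_simp
      ring
  have hPeq : ∀ s, 0 ≤ s → 0 < P s ∧ 0 < P'' s ∧
      P s * P'' s * (4 / 9 * P s - 2 / 3 * (s * P' s) + s ^ 2 * P'' s) = 1 := fun s hs0 => by
    rcases le_or_gt s 1 with hs | hs
    · simp only [hP, hP', hP'', if_pos hs]
      exact heq s ⟨hs0, hs⟩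
    · simp only [hP, hP', hP'', if_neg (not_le.mpr hs), max_eq_left hs.le]
      obtain ⟨h1, h2, h3⟩ := heq s⁻¹ (Ioo_subset_Icc_self (hinv s hs))
      have hs0 : 0 < s := by linarith
      have hpos : 0 < 4 / 9 * g s⁻¹ - 2 / 3 * (s⁻¹ * g' s⁻¹) + s⁻¹ ^ 2 * g'' s⁻¹ :=
        (pos_iff_pos_of_mul_pos (by rw [h3]; exact one_pos)).mp (mul_pos h1 h2)
      refine ⟨by positivity, by positivity, ?_⟩
      obtain ⟨e1, e2, e3⟩ := hrp s hs
      rw [e1, e2]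
      generalize s ^ (1 / 3 : ℝ) = r at e3
      generalize g s⁻¹ = a at *
      generalize g' s⁻¹ = b at *
      generalize g'' s⁻¹ = c at *
      have hss : s * s⁻¹ = 1 := mul_inv_cancel₀ hs0.ne'
      have hr : r ^ 3 * s⁻¹ = 1 := by rw [e3, hss]
      -- Inversion swaps the factors: V''(s) is s^(-2/3) times the old bracket at 1/s, and the new
      -- bracket is s^(-2/3) times g''(1/s). The powers cancel as 4/3 - 2/3 - 2/3 = 0.
      have e4 : 4 / 9 * (s * r * a) - 2 / 3 * (s * (4 / 3 * r * a - s⁻¹ * r * b)) +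
          s ^ 2 * (s⁻¹ * r * (4 / 9 * a - 2 / 3 * (s⁻¹ * b) + s⁻¹ ^ 2 * c)) = r * s⁻¹ * c := by
        field_simp
        ring
      rw [e4]
      set X := 4 / 9 * a - 2 / 3 * (s⁻¹ * b) + s⁻¹ ^ 2 * c
      linear_combination h3 + a * c * X * (r ^ 3 * s⁻¹) * hss + a * c * X * hr
  have hPinv : ∀ s, 0 < s → P s = s ^ (4 / 3 : ℝ) * P s⁻¹ := fun s hs0 => by
    rcases lt_trichotomy s 1 with hs | rfl | hs
    · have hs' : 1 < s⁻¹ := (one_lt_inv₀ hs0).mpr hs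
      simp only [hP]
      rw [if_pos hs.le, if_neg (not_le.mpr hs'), max_eq_left hs'.le, inv_inv, ← mul_assoc,
        ← Real.mul_rpow hs0.le (by positivity), mul_inv_cancel₀ hs0.ne', Real.one_rpow, one_mul]
    · simp
    · simp only [hP]
      rw [if_neg (not_le.mpr hs), max_eq_left hs.le, if_pos (hinv s hs).2.le]
  -- even extension
  set V' : ℝ → ℝ := fun s => if 0 ≤ s then P' s else -P' (-s) with hV'
  have hP'0 : P' 0 = 0 := by simp [hP', h0]
  have hVc' : Continuous V' := by
    refine Continuous.if_le hPc' (hPc'.comp continuous_neg).neg continuous_const continuous_id ?_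
    rintro s rfl; simp [hP'0]
  -- These are the gluing points; there the derivatives follow from continuity of the candidate
  -- derivative.
  have hcount : ({0, 1, -1} : Set ℝ).Countable := by simp
  have hs3 : ∀ s : ℝ, s ∉ ({0, 1, -1} : Set ℝ) → s ≠ 0 ∧ s ≠ 1 ∧ -s ≠ 1 := fun s hs => by
    simp only [mem_insert_iff, mem_singleton_iff, not_or] at hs
    exact ⟨hs.1, hs.2.1, fun h => hs.2.2 (by linarith)⟩
  have hsV' : ∀ s, s * V' s = |s| * P' |s| := fun s => by
    rcases le_or_gt 0 s with h | h
    · simp only [hV']; rw [if_pos h, abs_of_nonneg h]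
    · simp only [hV']; rw [if_neg (not_le.mpr h), abs_of_neg h]; ring
  refine ⟨fun s => P |s|, V', fun s => P'' |s|,
    hasDerivAt_of_off_countable hcount (hPc.comp continuous_abs) hVc' fun s hs => ?_,
    hasDerivAt_of_off_countable hcount hVc' (hPc''.comp continuous_abs) fun s hs => ?_,
    hPc''.comp continuous_abs, fun s => (hPeq |s| (abs_nonneg s)).1,
    fun s => (hPeq |s| (abs_nonneg s)).2.1, fun s => ?_, fun s => by simp only [abs_neg],
    fun s hs => ?_⟩
  · obtain ⟨hs0, hs1, hs2⟩ := hs3 s hs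
    rcases lt_or_gt_of_ne hs0 with h | h
    · have e : V' s = P' (-s) * (-1) := by simp only [hV']; rw [if_neg (not_le.mpr h)]; ring
      rw [e]
      refine ((hPd (-s) (by linarith) hs2).comp s (hasDerivAt_neg s)).congr_of_eventuallyEq ?_
      filter_upwards [Iio_mem_nhds h] with x hx
      simp [abs_of_neg (mem_Iio.mp hx)]
    · have e : V' s = P' s := by simp only [hV']; rw [if_pos h.le]
      rw [e]
      refine (hPd s h hs1).congr_of_eventuallyEq ?_
      filter_upwards [Ioi_mem_nhds h] with x hx
      rw [abs_of_pos (mem_Ioi.mp hx)]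
  · obtain ⟨hs0, hs1, hs2⟩ := hs3 s hs
    rcases lt_or_gt_of_ne hs0 with h | h
    · rw [abs_of_neg h]
      refine ((((hPd' (-s) (by linarith) hs2).comp s (hasDerivAt_neg s)).neg).congr_deriv
        (by ring)).congr_of_eventuallyEq ?_
      filter_upwards [Iio_mem_nhds h] with x hx
      exact if_neg (not_le.mpr hx)
    · rw [abs_of_pos h]
      refine (hPd' s h hs1).congr_of_eventuallyEq ?_
      filter_upwards [Ioi_mem_nhds h] with x hx
      exact if_pos (le_of_lt hx)
  · rw [hsV', ← sq_abs]
    exact (hPeq |s| (abs_nonneg s)).2.2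
  · rw [abs_inv]
    exact hPinv |s| (abs_pos.mpr hs)

/-! ### The homogeneous function w on the plane -/

/-- The extension of a profile to a function on the plane that is homogeneous of degree `4/3`. -/
noncomputable def homogeneousExtension (V : ℝ → ℝ) (x y : ℝ) : ℝ :=
  if y = 0 then |x| ^ (4 / 3 : ℝ) * V 0 else |y| ^ (4 / 3 : ℝ) * V (x / y)

theorem homogeneousExtension_of_ne {V : ℝ → ℝ} (x : ℝ) {y : ℝ} (hy : y ≠ 0) :
    homogeneousExtension V x y = |y| ^ (4 / 3 : ℝ) * V (x / y) := if_neg hy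

theorem homogeneousExtension_right_zero {V : ℝ → ℝ} (x : ℝ) :
    homogeneousExtension V x 0 = |x| ^ (4 / 3 : ℝ) * V 0 := if_pos rfl

theorem homogeneousExtension_zero {V : ℝ → ℝ} : homogeneousExtension V 0 0 = 0 := by
  rw [homogeneousExtension_right_zero, abs_zero, Real.zero_rpow (by norm_num), zero_mul]

theorem homogeneousExtension_smul (V : ℝ → ℝ) {r : ℝ} (hr : 0 < r) (x y : ℝ) :
    homogeneousExtension V (r * x) (r * y) = r ^ (4 / 3 : ℝ) * homogeneousExtension V x y := by
  rcases eq_or_ne y 0 with rfl | hy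
  · rw [mul_zero, homogeneousExtension_right_zero, homogeneousExtension_right_zero, abs_mul,
      abs_of_pos hr, Real.mul_rpow hr.le (abs_nonneg x), mul_assoc]
  · rw [homogeneousExtension_of_ne _ hy, homogeneousExtension_of_ne _ (mul_ne_zero hr.ne' hy),
      abs_mul, abs_of_pos hr, Real.mul_rpow hr.le (abs_nonneg y), mul_assoc,
      mul_div_mul_left _ _ hr.ne']

/-- `f` is twice differentiable at `t₀` with second derivative `a`. -/
def HasSecondDerivAt (f : ℝ → ℝ) (a t₀ : ℝ) : Prop :=
  ∃ f' : ℝ → ℝ, (∀ᶠ t in 𝓝 t₀, HasDerivAt f (f' t) t) ∧ HasDerivAt f' a t₀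

namespace HasSecondDerivAt

variable {f : ℝ → ℝ} {a t₀ : ℝ}

theorem of_hasDerivAt {f' f'' : ℝ → ℝ} (h : ∀ x, HasDerivAt f (f' x) x)
    (h' : ∀ x, HasDerivAt f' (f'' x) x) (t : ℝ) : HasSecondDerivAt f (f'' t) t :=
  ⟨f', Eventually.of_forall h, h' t⟩

theorem shift (h : HasSecondDerivAt f a t₀) : HasSecondDerivAt (fun t => f (t₀ + t)) a 0 := by
  obtain ⟨f', h1, h2⟩ := h
  refine ⟨fun t => f' (t₀ + t), ?_, HasDerivAt.comp_const_add t₀ 0 (by simpa using h2)⟩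
  have : Tendsto (fun t : ℝ => t₀ + t) (𝓝 0) (𝓝 t₀) := by
    simpa [ContinuousAt] using (continuous_const_add t₀).continuousAt (x := (0 : ℝ))
  exact (this.eventually h1).mono fun t ht => ht.comp_const_add t₀ t

theorem const_mul (c : ℝ) (h : HasSecondDerivAt f a t₀) :
    HasSecondDerivAt (fun t => c * f t) (c * a) t₀ := by
  obtain ⟨f', h1, h2⟩ := h
  exact ⟨fun t => c * f' t, h1.mono fun t ht => ht.const_mul c, h2.const_mul c⟩

theorem mul_const (c : ℝ) (h : HasSecondDerivAt f a t₀) :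
    HasSecondDerivAt (fun t => f t * c) (a * c) t₀ := by
  simpa only [mul_comm] using h.const_mul c

theorem add_const (c : ℝ) (h : HasSecondDerivAt f a t₀) :
    HasSecondDerivAt (fun t => f t + c) a t₀ := by
  obtain ⟨f', h1, h2⟩ := h
  exact ⟨f', h1.mono fun t ht => ht.add_const c, h2⟩

end HasSecondDerivAt

theorem hasDerivAt_abs_rpow_of_ne {z : ℝ} (hz : z ≠ 0) (p : ℝ) :
    HasDerivAt (fun z : ℝ => |z| ^ p) (p * |z| ^ p / z) z := by
  have h := (hasDerivAt_abs hz).rpow_const (p := p) (Or.inl (abs_ne_zero.mpr hz))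
  refine h.congr_deriv ?_
  rw [Real.rpow_sub_one (abs_ne_zero.mpr hz)]
  rcases lt_or_gt_of_ne hz with h | h
  · rw [abs_of_neg h, sign_neg h]
    simp only [SignType.coe_neg, SignType.coe_one]
    field_simp
  · rw [abs_of_pos h, sign_pos h]
    simp only [SignType.coe_one]
    field_simp

theorem convexOn_abs_rpow (x : ℝ) :
    ConvexOn ℝ univ fun t : ℝ => |x + t| ^ (4 / 3 : ℝ) := by
  refine ⟨convex_univ, fun s _ t _ a b ha hb hab => ?_⟩
  have h := (convexOn_rpow (p := 4 / 3) (by norm_num)).2 (abs_nonneg (x + s)) (abs_nonneg (x + t))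
    ha hb hab
  refine le_trans ?_ h
  refine Real.rpow_le_rpow (abs_nonneg _) ?_ (by norm_num)
  have e : x + (a • s + b • t) = a * (x + s) + b * (x + t) := by
    simp only [smul_eq_mul]; linear_combination -x * hab
  rw [e, smul_eq_mul, smul_eq_mul]
  refine (abs_add_le _ _).trans_eq ?_
  rw [abs_mul, abs_mul, abs_of_nonneg ha, abs_of_nonneg hb]

namespace IsProfile

variable {V V' V'' : ℝ → ℝ}

/-- This is the inversion law of the profile. It carries every statement proved for y ≠ 0 over to
the punctured axis y = 0. -/
theorem extension_comm (hV : IsProfile V V' V'') (x y : ℝ) :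
    homogeneousExtension V x y = homogeneousExtension V y x := by
  rcases eq_or_ne y 0 with rfl | hy <;> rcases eq_or_ne x 0 with rfl | hx
  · rfl
  · rw [homogeneousExtension_right_zero, homogeneousExtension_of_ne _ hx, zero_div]
  · rw [homogeneousExtension_right_zero, homogeneousExtension_of_ne _ hy, zero_div]
  · rw [homogeneousExtension_of_ne _ hx, homogeneousExtension_of_ne _ hy,
      hV.inversion (x / y) (div_ne_zero hx hy), inv_div, abs_div, ← mul_assoc,
      ← Real.mul_rpow (abs_nonneg y) (by positivity), mul_div_cancel₀ _ (abs_ne_zero.mpr hy)]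

theorem extension_nonneg (hV : IsProfile V V' V'') (x y : ℝ) : 0 ≤ homogeneousExtension V x y := by
  unfold homogeneousExtension
  split_ifs
  · have := hV.pos 0; positivity
  · have := hV.pos (x / y); positivity

theorem contDiff (hV : IsProfile V V' V'') : ContDiff ℝ 2 V :=
  contDiff_two_of_hasDerivAt hV.hasDerivAt hV.hasDerivAt' hV.continuous

/-- By symmetry one may take |x| ≤ |y|, where only values of V on the compact set [-1, 1] enter. The
bound gives continuity at the origin. -/
theorem exists_extension_le (hV : IsProfile V V' V'') : ∃ C : ℝ, ∀ x y : ℝ,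
    homogeneousExtension V x y ≤ C * (|x| ^ (4 / 3 : ℝ) + |y| ^ (4 / 3 : ℝ)) := by
  obtain ⟨C, hC⟩ := isCompact_Icc.exists_bound_of_continuousOn
    (hV.contDiff.continuous.continuousOn (s := Icc (-1) 1))
  refine ⟨C, fun x y => ?_⟩
  have hC0 : 0 ≤ C := (norm_nonneg _).trans (hC 0 (by norm_num))
  wlog h : |x| ≤ |y| generalizing x y
  · rw [hV.extension_comm, add_comm]
    exact this y x (le_of_not_ge h)
  rcases eq_or_ne y 0 with rfl | hy
  · rw [abs_zero] at h
    rw [abs_nonpos_iff.mp h, homogeneousExtension_zero]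
    positivity
  · rw [homogeneousExtension_of_ne _ hy, mul_add, mul_comm]
    have h1 : x / y ∈ Icc (-1 : ℝ) 1 := abs_le.mp (by
      rw [abs_div, div_le_one₀ (abs_pos.mpr hy)]; exact h)
    have h2 := (le_abs_self _).trans (hC _ h1)
    have h3 : 0 ≤ C * |x| ^ (4 / 3 : ℝ) := by positivity
    have := mul_le_mul_of_nonneg_right h2 (by positivity : 0 ≤ |y| ^ (4 / 3 : ℝ))
    linarith

theorem hasSecondDerivAt_fst (hV : IsProfile V V' V'') (x : ℝ) {y : ℝ} (hy : y ≠ 0) :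
    HasSecondDerivAt (fun t => homogeneousExtension V t y)
      (|y| ^ (4 / 3 : ℝ) * (V'' (x / y) / y ^ 2)) x := by
  have e : (fun t => homogeneousExtension V t y) = fun t => |y| ^ (4 / 3 : ℝ) * V (t / y) :=
    funext fun t => homogeneousExtension_of_ne t hy
  rw [e]
  have hd : ∀ t : ℝ, HasDerivAt (fun t => t / y) (1 / y) t := fun t => (hasDerivAt_id t).div_const y
  refine HasSecondDerivAt.const_mul _ (HasSecondDerivAt.of_hasDerivAt
    (f' := fun t => V' (t / y) * (1 / y)) (f'' := fun t => V'' (t / y) / y ^ 2)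
    (fun t => (hV.hasDerivAt _).comp t (hd t)) (fun t => ?_) x)
  refine (((hV.hasDerivAt' _).comp t (hd t)).mul_const (1 / y)).congr_deriv ?_
  field_simp

/-- The bracket of the profile equation arises here, from differentiating |y|^(4/3) V(x/y) twice in
y. -/
theorem hasSecondDerivAt_snd (hV : IsProfile V V' V'') (x : ℝ) {y : ℝ} (hy : y ≠ 0) :
    HasSecondDerivAt (fun t => homogeneousExtension V x t) (|y| ^ (4 / 3 : ℝ) / y ^ 2 *
      (4 / 9 * V (x / y) - 2 / 3 * (x / y * V' (x / y)) + (x / y) ^ 2 * V'' (x / y))) y := by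
  have hd : ∀ z : ℝ, z ≠ 0 → HasDerivAt (fun z => x / z) (-x / z ^ 2) z := fun z hz => by
    simpa [div_eq_mul_inv] using (hasDerivAt_inv hz).const_mul x
  have hne : ∀ᶠ z in 𝓝 y, z ≠ 0 := isOpen_ne.mem_nhds hy
  refine ⟨fun z => |z| ^ (4 / 3 : ℝ) * (4 / 3 * (V (x / z) / z) - x * (V' (x / z) / z ^ 2)), ?_, ?_⟩
  · filter_upwards [hne.eventually_nhds] with z hz
    have hz0 : z ≠ 0 := hz.self_of_nhds
    refine HasDerivAt.congr_of_eventuallyEq (f := fun z => |z| ^ (4 / 3 : ℝ) * V (x / z)) ?_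
      (hz.mono fun t ht => homogeneousExtension_of_ne x ht)
    refine ((hasDerivAt_abs_rpow_of_ne hz0 _).mul ((hV.hasDerivAt _).comp z (hd z hz0))).congr_deriv ?_
    simp only [Function.comp]
    field_simp
    ring
  · refine ((hasDerivAt_abs_rpow_of_ne hy _).mul
      (((((hV.hasDerivAt _).comp y (hd y hy)).div (hasDerivAt_id y) hy).const_mul (4 / 3)).sub
      ((((hV.hasDerivAt' _).comp y (hd y hy)).div (hasDerivAt_pow 2 y)
        (pow_ne_zero 2 hy)).const_mul x))).congr_deriv ?_
    simp only [Pi.sub_apply, Pi.div_apply, Function.comp, id]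
    field_simp
    push_cast
    ring

/-- The homogeneous extension of a profile solves `w w₁₁ w₂₂ = 1` away from the origin. -/
theorem exists_secondDerivs (hV : IsProfile V V' V'') {x y : ℝ} (h : x ≠ 0 ∨ y ≠ 0) :
    ∃ a b : ℝ, HasSecondDerivAt (fun t => homogeneousExtension V t y) a x ∧
      HasSecondDerivAt (fun t => homogeneousExtension V x t) b y ∧ 0 < a ∧ 0 < b ∧
      homogeneousExtension V x y * a * b = 1 := by
  wlog hy : y ≠ 0 generalizing x y
  · obtain ⟨a, b, h1, h2, h3, h4, h5⟩ := this h.symm (h.resolve_right hy)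
    simp only [hV.extension_comm y, hV.extension_comm _ x] at h1 h2 h5
    refine ⟨b, a, ?_, ?_, h4, h3, by linarith⟩
    · simpa only [hV.extension_comm y] using h2
    · exact h1
  have hp : 0 < |y| ^ (4 / 3 : ℝ) := Real.rpow_pos_of_pos (abs_pos.mpr hy) _
  -- The degree balance 3 · 4/3 = 2 + 2: the three powers of |y| cancel the two divisions by y².
  have hp3 : (|y| ^ (4 / 3 : ℝ)) ^ 3 = y ^ 2 * y ^ 2 := by
    rw [← Real.rpow_natCast, ← Real.rpow_mul (abs_nonneg y), ← sq_abs, ← pow_add,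
      ← Real.rpow_natCast]
    norm_num
  have hV0 := hV.pos (x / y)
  have hV2 := hV.pos' (x / y)
  have heq := hV.equation (x / y)
  have hy2 : 0 < y ^ 2 := by positivity
  have hX : 0 < 4 / 9 * V (x / y) - 2 / 3 * (x / y * V' (x / y)) + (x / y) ^ 2 * V'' (x / y) :=
    (pos_iff_pos_of_mul_pos (by rw [heq]; exact one_pos)).mp (mul_pos hV0 hV2)
  refine ⟨_, _, hV.hasSecondDerivAt_fst x hy, hV.hasSecondDerivAt_snd x hy, by positivity,
    by positivity, ?_⟩
  rw [homogeneousExtension_of_ne _ hy]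
  generalize 4 / 9 * V (x / y) - 2 / 3 * (x / y * V' (x / y)) + (x / y) ^ 2 * V'' (x / y) = X at *
  generalize |y| ^ (4 / 3 : ℝ) = p at *
  generalize V (x / y) = a at *
  generalize V'' (x / y) = c at *
  field_simp
  linear_combination p ^ 3 * heq + hp3

/-- The line y = 0 passes through the singular point and is treated directly as a multiple of
|t|^(4/3); on the others V'' > 0 suffices. -/
theorem convexOn_fst (hV : IsProfile V V' V'') (x y : ℝ) :
    ConvexOn ℝ univ fun t => homogeneousExtension V (x + t) y := by
  rcases eq_or_ne y 0 with rfl | hy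
  · simp only [homogeneousExtension_right_zero, mul_comm _ (V 0)]
    exact (convexOn_abs_rpow x).smul (hV.pos 0).le
  · simp only [homogeneousExtension_of_ne _ hy]
    have hd : ∀ t : ℝ, HasDerivAt (fun t => (x + t) / y) (1 / y) t := fun t =>
      ((hasDerivAt_id t).const_add x).div_const y
    refine ConvexOn.smul (c := |y| ^ (4 / 3 : ℝ)) (by positivity) (convexOn_univ_of_hasDerivAt
      (f' := fun t => V' ((x + t) / y) * (1 / y))
      (f'' := fun t => V'' ((x + t) / y) * (1 / y) * (1 / y))
      (fun t => (hV.hasDerivAt _).comp t (hd t))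
      (fun t => ((hV.hasDerivAt' _).comp t (hd t)).mul_const (1 / y)) fun t => ?_)
    rw [mul_assoc]
    exact mul_nonneg (hV.pos' _).le (mul_self_nonneg _)

theorem convexOn_snd (hV : IsProfile V V' V'') (x y : ℝ) :
    ConvexOn ℝ univ fun t => homogeneousExtension V x (y + t) := by
  simpa only [hV.extension_comm x] using hV.convexOn_fst y x

theorem contDiffOn_extension (hV : IsProfile V V' V'') : ContDiffOn ℝ 2
    (fun x : EuclideanSpace ℝ (Fin 2) => homogeneousExtension V (x 0) (x 1)) {0}ᶜ := by
  have key : ∀ (i j : Fin 2) (x : EuclideanSpace ℝ (Fin 2)), x j ≠ 0 →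
      ContDiffAt ℝ 2 (fun x : EuclideanSpace ℝ (Fin 2) => homogeneousExtension V (x i) (x j)) x := by
    intro i j x hx
    have hc : ∀ k : Fin 2, ContDiffAt ℝ 2 (fun x : EuclideanSpace ℝ (Fin 2) => x k) x := fun k => by
      fun_prop
    have h0 : ContDiffAt ℝ 2 (fun x : EuclideanSpace ℝ (Fin 2) => |x j|) x :=
      ContDiffAt.comp (g := fun y : ℝ => |y|) x (contDiffAt_abs hx) (hc j)
    have h1 : ContDiffAt ℝ 2 (fun x : EuclideanSpace ℝ (Fin 2) =>
        |x j| ^ (4 / 3 : ℝ) * V (x i / x j)) x :=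
      (h0.rpow_const_of_ne (abs_ne_zero.mpr hx)).mul
        (ContDiffAt.comp (g := V) x hV.contDiff.contDiffAt ((hc i).div (hc j) hx))
    refine h1.congr_of_eventuallyEq ?_
    have hcont : Continuous fun x : EuclideanSpace ℝ (Fin 2) => x j := by fun_prop
    filter_upwards [hcont.continuousAt.eventually_ne hx] with z hz
    exact homogeneousExtension_of_ne _ hz
  intro x hx
  refine ContDiffAt.contDiffWithinAt ?_
  by_cases h1 : x 1 = 0
  · have h0 : x 0 ≠ 0 := fun h0 => hx (by ext i; fin_cases i <;> simp [h0, h1])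
    exact (key 1 0 x h0).congr_of_eventuallyEq
      (Eventually.of_forall fun z => hV.extension_comm _ _)
  · exact key 0 1 x h1

theorem continuous_extension (hV : IsProfile V V' V'') : Continuous
    fun x : EuclideanSpace ℝ (Fin 2) => homogeneousExtension V (x 0) (x 1) := by
  rw [continuous_iff_continuousAt]
  intro x
  rcases eq_or_ne x 0 with rfl | hx
  · obtain ⟨C, hC⟩ := hV.exists_extension_le
    have hb : Continuous fun x : EuclideanSpace ℝ (Fin 2) =>
        C * (|x 0| ^ (4 / 3 : ℝ) + |x 1| ^ (4 / 3 : ℝ)) := by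
      have hc : ∀ k : Fin 2, Continuous fun x : EuclideanSpace ℝ (Fin 2) =>
          |x k| ^ (4 / 3 : ℝ) := fun k =>
        Continuous.rpow_const (by fun_prop) fun _ => Or.inr (by norm_num)
      exact continuous_const.mul ((hc 0).add (hc 1))
    have hb0 := hb.tendsto 0
    simp only [PiLp.zero_apply, abs_zero] at hb0
    rw [Real.zero_rpow (by norm_num), add_zero, mul_zero] at hb0
    rw [ContinuousAt]
    simp only [PiLp.zero_apply, homogeneousExtension_zero]
    exact squeeze_zero (fun x => hV.extension_nonneg _ _) (fun x => hC _ _) hb0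
  · exact hV.contDiffOn_extension.continuousOn.continuousAt (isOpen_compl_singleton.mem_nhds hx)

end IsProfile

/-! ### The product solution in dimension m + 3 -/

theorem line_apply_self {n : ℕ} (x : EuclideanSpace ℝ (Fin n)) (i : Fin n) (t : ℝ) :
    (x + t • EuclideanSpace.single i (1 : ℝ)) i = x i + t := by
  simp

theorem line_apply_ne {n : ℕ} (x : EuclideanSpace ℝ (Fin n)) {i j : Fin n} (h : j ≠ i) (t : ℝ) :
    (x + t • EuclideanSpace.single i (1 : ℝ)) j = x j := by
  simp [h]

theorem HasSecondDerivAt.hasSecondPartialAt {n : ℕ} {u : EuclideanSpace ℝ (Fin n) → ℝ} {i : Fin n}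
    {a : ℝ} {x : EuclideanSpace ℝ (Fin n)} {f : ℝ → ℝ} (h : HasSecondDerivAt f a 0)
    (hf : ∀ t : ℝ, u (x + t • EuclideanSpace.single i (1 : ℝ)) = f t) :
    HasSecondPartialAt u i a x := by
  obtain rfl : (fun t : ℝ => u (x + t • EuclideanSpace.single i (1 : ℝ))) = f := funext hf
  exact h

/-- The function `w (x₀, x₁) h (x₂) + ∑ i ≥ 3, xᵢ² / 2`. -/
noncomputable def productSolution (V h : ℝ → ℝ) {m : ℕ} (x : EuclideanSpace ℝ (Fin (m + 3))) : ℝ :=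
  homogeneousExtension V (x 0) (x 1) * h (x 2) + ∑ k : Fin m, x k.succ.succ.succ ^ 2 / 2

theorem val_two_fin_add_three (m : ℕ) : ((2 : Fin (m + 3)) : ℕ) = 2 :=
  Nat.mod_eq_of_lt (show 2 < m + 3 by omega)

section ProductSolution

variable {V V' V'' h h' h'' : ℝ → ℝ} {m : ℕ} (x : EuclideanSpace ℝ (Fin (m + 3)))

theorem productSolution_line_zero (t : ℝ) :
    productSolution V h (x + t • EuclideanSpace.single 0 (1 : ℝ)) =
      homogeneousExtension V (x 0 + t) (x 1) * h (x 2) + ∑ k : Fin m, x k.succ.succ.succ ^ 2 / 2 := by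
  have h1 : (1 : Fin (m + 3)) ≠ 0 := by simp
  have h2 : (2 : Fin (m + 3)) ≠ 0 := by rw [Ne, Fin.ext_iff, val_two_fin_add_three]; simp
  simp only [productSolution, line_apply_self, line_apply_ne x h1, line_apply_ne x h2,
    line_apply_ne x (Fin.succ_ne_zero _)]

theorem productSolution_line_one (t : ℝ) :
    productSolution V h (x + t • EuclideanSpace.single 1 (1 : ℝ)) =
      homogeneousExtension V (x 0) (x 1 + t) * h (x 2) + ∑ k : Fin m, x k.succ.succ.succ ^ 2 / 2 := by
  have h0 : (0 : Fin (m + 3)) ≠ 1 := by simp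
  have h2 : (2 : Fin (m + 3)) ≠ 1 := by rw [Ne, Fin.ext_iff, val_two_fin_add_three]; simp
  have h3 : ∀ k : Fin m, k.succ.succ.succ ≠ 1 := fun k => by simp [Fin.ext_iff]
  simp only [productSolution, line_apply_self, line_apply_ne x h0, line_apply_ne x h2,
    line_apply_ne x (h3 _)]

theorem productSolution_line_two (t : ℝ) :
    productSolution V h (x + t • EuclideanSpace.single 2 (1 : ℝ)) =
      homogeneousExtension V (x 0) (x 1) * h (x 2 + t) + ∑ k : Fin m, x k.succ.succ.succ ^ 2 / 2 := by
  have h0 : (0 : Fin (m + 3)) ≠ 2 := by rw [Ne, Fin.ext_iff, val_two_fin_add_three]; simp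
  have h1 : (1 : Fin (m + 3)) ≠ 2 := by rw [Ne, Fin.ext_iff, val_two_fin_add_three]; simp
  have h3 : ∀ k : Fin m, k.succ.succ.succ ≠ 2 := fun k => by rw [Ne, Fin.ext_iff, val_two_fin_add_three]; simp
  simp only [productSolution, line_apply_self, line_apply_ne x h0, line_apply_ne x h1,
    line_apply_ne x (h3 _)]

theorem productSolution_line_succ (k : Fin m) (t : ℝ) :
    productSolution V h (x + t • EuclideanSpace.single k.succ.succ.succ (1 : ℝ)) =
      (x k.succ.succ.succ + t) ^ 2 / 2 +
        (productSolution V h x - x k.succ.succ.succ ^ 2 / 2) := by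
  have h0 : (0 : Fin (m + 3)) ≠ k.succ.succ.succ := by simp [Fin.ext_iff]
  have h1 : (1 : Fin (m + 3)) ≠ k.succ.succ.succ := by simp [Fin.ext_iff]
  have h2 : (2 : Fin (m + 3)) ≠ k.succ.succ.succ := by rw [Ne, Fin.ext_iff, val_two_fin_add_three]; simp
  have h3 : ∀ j : Fin m, j ≠ k → j.succ.succ.succ ≠ k.succ.succ.succ := fun j hj e =>
    hj (Fin.succ_injective _ (Fin.succ_injective _ (Fin.succ_injective _ e)))
  simp only [productSolution, line_apply_ne x h0, line_apply_ne x h1, line_apply_ne x h2]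
  rw [← Finset.add_sum_erase _ _ (Finset.mem_univ k),
    ← Finset.add_sum_erase _ (fun k : Fin m => x k.succ.succ.succ ^ 2 / 2) (Finset.mem_univ k),
    line_apply_self]
  have e : ∑ j ∈ Finset.univ.erase k,
      (x + t • EuclideanSpace.single k.succ.succ.succ (1 : ℝ)) j.succ.succ.succ ^ 2 / 2 =
      ∑ j ∈ Finset.univ.erase k, x j.succ.succ.succ ^ 2 / 2 :=
    Finset.sum_congr rfl fun j hj => by rw [line_apply_ne x (h3 j (Finset.ne_of_mem_erase hj))]
  rw [e]
  ring

/-- Case distinction on the coordinates of `ℝ^(m+3)`. -/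
theorem forall_fin_add_three {p : Fin (m + 3) → Prop} (h0 : p 0) (h1 : p 1) (h2 : p 2)
    (h3 : ∀ k : Fin m, p k.succ.succ.succ) (i : Fin (m + 3)) : p i :=
  Fin.cases h0 (Fin.cases h1 (Fin.cases h2 h3)) i

theorem hasSecondDerivAt_half_sq (c : ℝ) : HasSecondDerivAt (fun t => t ^ 2 / 2) 1 c :=
  HasSecondDerivAt.of_hasDerivAt (f' := fun t => t) (f'' := fun _ => 1)
    (fun t => ((hasDerivAt_pow 2 t).div_const 2).congr_deriv (by norm_num))
    (fun t => hasDerivAt_id t) c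

theorem convexOn_half_sq (c : ℝ) : ConvexOn ℝ univ fun t : ℝ => (c + t) ^ 2 / 2 :=
  convexOn_univ_of_hasDerivAt (f' := fun t => c + t) (f'' := fun _ => 1)
    (fun t => ((((hasDerivAt_id t).const_add c).pow 2).div_const 2).congr_deriv (by simp))
    (fun t => (hasDerivAt_id t).const_add c) fun _ => zero_le_one

theorem continuous_extension_coords (hV : IsProfile V V' V'') :
    Continuous fun x : EuclideanSpace ℝ (Fin (m + 3)) => homogeneousExtension V (x 0) (x 1) := by
  have : Continuous fun x : EuclideanSpace ℝ (Fin (m + 3)) => !₂[x 0, x 1] := by fun_prop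
  simpa using! hV.continuous_extension.comp this

theorem secondDeriv_pos_of_sq_mul_eq_one (hpos : ∀ s, 0 < h s) (heq : ∀ s, h s ^ 2 * h'' s = 1)
    (s : ℝ) : 0 < h'' s :=
  pos_of_mul_pos_right (by rw [heq]; exact one_pos) (pow_pos (hpos s) 2).le

theorem coordinateConvex_productSolution (hV : IsProfile V V' V'') (hh : ∀ s, HasDerivAt h (h' s) s)
    (hh' : ∀ s, HasDerivAt h' (h'' s) s) (hpos : ∀ s, 0 < h s)
    (heq : ∀ s, h s ^ 2 * h'' s = 1) :
    CoordinateConvex (productSolution V h (m := m)) := by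
  constructor
  · have hhc : Continuous h := continuous_iff_continuousAt.mpr fun s => (hh s).continuousAt
    refine ((continuous_extension_coords hV).mul (hhc.comp ?_)).add ?_ <;> fun_prop
  · refine fun x => forall_fin_add_three ?_ ?_ ?_ fun k => ?_
    · simp only [productSolution_line_zero, mul_comm _ (h _)]
      exact ((hV.convexOn_fst _ _).smul (hpos _).le).add_const _
    · simp only [productSolution_line_one, mul_comm _ (h _)]
      exact ((hV.convexOn_snd _ _).smul (hpos _).le).add_const _
    · simp only [productSolution_line_two]
      exact ((convexOn_univ_of_hasDerivAt (fun t => (hh _).comp_const_add (x 2) t)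
        (fun t => (hh' _).comp_const_add (x 2) t)
        fun t => (secondDeriv_pos_of_sq_mul_eq_one hpos heq _).le).smul
        (hV.extension_nonneg _ _)).add_const _
    · simp only [productSolution_line_succ]
      exact (convexOn_half_sq _).add_const _

/-- The entries are w₁₁ h, w₂₂ h, w h'' and 1 for each added square, so their product is (w w₁₁
w₂₂)(h² h''). -/
theorem exists_secondPartials_productSolution (hV : IsProfile V V' V'')
    (hh : ∀ s, HasDerivAt h (h' s) s) (hh' : ∀ s, HasDerivAt h' (h'' s) s) (hpos : ∀ s, 0 < h s)
    (heq : ∀ s, h s ^ 2 * h'' s = 1) (hx : x 0 ≠ 0 ∨ x 1 ≠ 0) :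
    ∃ a : Fin (m + 3) → ℝ, (∀ i, HasSecondPartialAt (productSolution V h) i (a i) x) ∧
      (∀ i, 0 ≤ a i) ∧ ∏ i, a i = 1 := by
  obtain ⟨a, b, ha, hb, ha0, hb0, hab⟩ := hV.exists_secondDerivs hx
  have hc := HasSecondDerivAt.of_hasDerivAt hh hh' (x 2)
  refine ⟨Fin.cons (a * h (x 2)) (Fin.cons (b * h (x 2)) (Fin.cons
    (homogeneousExtension V (x 0) (x 1) * h'' (x 2)) fun _ => 1)),
    forall_fin_add_three ?_ ?_ ?_ fun k => ?_, forall_fin_add_three ?_ ?_ ?_ fun k => ?_, ?_⟩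
  · exact ((ha.shift.mul_const _).add_const _).hasSecondPartialAt (productSolution_line_zero x)
  · exact ((hb.shift.mul_const _).add_const _).hasSecondPartialAt (productSolution_line_one x)
  · exact ((hc.shift.const_mul _).add_const _).hasSecondPartialAt (productSolution_line_two x)
  · exact ((hasSecondDerivAt_half_sq _).shift.add_const _).hasSecondPartialAt
      (productSolution_line_succ x k)
  · exact mul_nonneg ha0.le (hpos _).le
  · exact mul_nonneg hb0.le (hpos _).le
  · exact mul_nonneg (hV.extension_nonneg _ _) (secondDeriv_pos_of_sq_mul_eq_one hpos heq _).le
  · exact zero_le_one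
  · simp only [Fin.prod_univ_succ, Fin.cons_zero, Fin.cons_succ, Finset.prod_const_one]
    linear_combination hab * h (x 2) ^ 2 * h'' (x 2) + heq (x 2)

theorem not_isLocalMax_productSolution_sub (hV : IsProfile V V' V'') (hpos : ∀ s, 0 < h s)
    {x : EuclideanSpace ℝ (Fin (m + 3))} (h0 : x 0 = 0) (h1 : x 1 = 0)
    {φ : EuclideanSpace ℝ (Fin (m + 3)) → ℝ} (hφ : ContDiffAt ℝ 2 φ x) :
    ¬ IsLocalMax (fun x => productSolution V h x - φ x) x := by
  refine not_isLocalMax_sub_of_line (i := 0) (c := V 0 * h (x 2))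
    (mul_pos (hV.pos 0) (hpos _)) (fun t => ?_) hφ
  rw [productSolution_line_zero, productSolution, h0, h1, homogeneousExtension_zero, zero_add,
    homogeneousExtension_right_zero]
  ring

theorem isGlobalViscositySolution_productSolution (hV : IsProfile V V' V'')
    (hh : ∀ s, HasDerivAt h (h' s) s) (hh' : ∀ s, HasDerivAt h' (h'' s) s) (hpos : ∀ s, 0 < h s)
    (heq : ∀ s, h s ^ 2 * h'' s = 1) :
    IsGlobalViscositySolution (productSolution V h (m := m)) := by
  refine ⟨coordinateConvex_productSolution hV hh hh' hpos heq, fun φ x hφ hmax => ?_,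
    fun φ x hφ hmin hnn => ?_⟩
  · by_cases hx : x 0 = 0 ∧ x 1 = 0
    · exact absurd hmax (not_isLocalMax_productSolution_sub hV hpos hx.1 hx.2 hφ)
    · obtain ⟨a, ha, ha0, hprod⟩ := exists_secondPartials_productSolution x hV hh hh' hpos heq
        (not_and_or.mp hx)
      exact one_le_coordinateOperator ha ha0 hprod hφ hmax
  · by_cases hx : x 0 = 0 ∧ x 1 = 0
    -- Here w = 0, so the function is constant in direction 2 and its second derivative w h''
    -- vanishes.
    · refine coordinateOperator_le_one_of_flat (i := 2) ?_ hφ hmin hnn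
      have hc := (HasSecondDerivAt.of_hasDerivAt hh hh' (x 2)).shift.const_mul
        (homogeneousExtension V (x 0) (x 1))
      have := (hc.add_const _).hasSecondPartialAt (productSolution_line_two x)
      rwa [hx.1, hx.2, homogeneousExtension_zero, zero_mul] at this
    · obtain ⟨a, ha, -, hprod⟩ := exists_secondPartials_productSolution x hV hh hh' hpos heq
        (not_and_or.mp hx)
      exact coordinateOperator_le_one ha hprod hφ hmin hnn

/-- Were the function C², it would be its own test function from above at the origin. -/
theorem not_contDiff_productSolution (hV : IsProfile V V' V'') (hpos : ∀ s, 0 < h s) :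
    ¬ ContDiff ℝ 2 (productSolution V h (m := m)) := fun hc =>
  not_isLocalMax_productSolution_sub hV hpos (x := 0) rfl rfl hc.contDiffAt
    (Eventually.of_forall fun x => by simp)

end ProductSolution

/-! ### The planar properties of w and the theorem -/

theorem IsProfile.coordinateConvex_extension {V V' V'' : ℝ → ℝ} (hV : IsProfile V V' V'') :
    CoordinateConvex fun x : EuclideanSpace ℝ (Fin 2) => homogeneousExtension V (x 0) (x 1) := by
  refine ⟨hV.continuous_extension, fun x i => ?_⟩
  fin_cases i
  · simpa using hV.convexOn_fst (x 0) (x 1)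
  · simpa using hV.convexOn_snd (x 0) (x 1)

theorem IsProfile.extension_mul_secondPartials {V V' V'' : ℝ → ℝ} (hV : IsProfile V V' V'')
    {x : EuclideanSpace ℝ (Fin 2)} (hx : x ≠ 0) :
    homogeneousExtension V (x 0) (x 1) *
      secondPartial (fun x : EuclideanSpace ℝ (Fin 2) => homogeneousExtension V (x 0) (x 1)) 0 x *
      secondPartial (fun x : EuclideanSpace ℝ (Fin 2) => homogeneousExtension V (x 0) (x 1)) 1 x
      = 1 := by
  have h : x 0 ≠ 0 ∨ x 1 ≠ 0 := by
    by_contra! h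
    exact hx (by ext i; fin_cases i <;> simp [h.1, h.2])
  obtain ⟨a, b, ha, hb, -, -, hab⟩ := hV.exists_secondDerivs h
  rw [(ha.shift.hasSecondPartialAt fun t => by simp).secondPartial_eq,
    (hb.shift.hasSecondPartialAt fun t => by simp).secondPartial_eq, hab]

theorem theorem1p6 :
    (∀ n : ℕ, 3 ≤ n →
      ∃ u : EuclideanSpace ℝ (Fin n) → ℝ, IsGlobalViscositySolution u ∧ ¬ ContDiff ℝ 2 u) ∧
    (∃ (w : EuclideanSpace ℝ (Fin 2) → ℝ) (h : ℝ → ℝ),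
      -- `h` is a positive solution of `h² h'' = 1` on `ℝ`
      (ContDiff ℝ 2 h ∧ ∀ s : ℝ, 0 < h s ∧ h s ^ 2 * iteratedDeriv 2 h s = 1) ∧
      -- `w ≥ 0` is coordinate-convex and homogeneous of degree `4/3`
      CoordinateConvex w ∧ (∀ x, 0 ≤ w x) ∧
      (∀ (r : ℝ) (x : EuclideanSpace ℝ (Fin 2)), 0 < r → w (r • x) = r ^ (4 / 3 : ℝ) * w x) ∧
      -- `w w₁₁ w₂₂ = 1` away from the origin, in the classical sense
      (ContDiffOn ℝ 2 w {0}ᶜ ∧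
        ∀ x, x ≠ 0 → w x * secondPartial w 0 x * secondPartial w 1 x = 1) ∧
      -- `u = w(x₁, x₂) h(x₃)` is a global non-classical viscosity solution in dimension three
      IsGlobalViscositySolution
        (fun x : EuclideanSpace ℝ (Fin 3) => w !₂[x 0, x 1] * h (x 2)) ∧
      ¬ ContDiff ℝ 2 (fun x : EuclideanSpace ℝ (Fin 3) => w !₂[x 0, x 1] * h (x 2))) := by
  obtain ⟨V, V', V'', hV⟩ := exists_isProfile
  obtain ⟨h, h', h'', hh, hh', hc, hpos, heq⟩ := exists_sq_mul_secondDeriv_eq_one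
  -- For m = 0 the sum of added squares is empty, leaving the pure product.
  have e3 : (fun x : EuclideanSpace ℝ (Fin 3) =>
      homogeneousExtension V ((!₂[x 0, x 1] : EuclideanSpace ℝ (Fin 2)) 0)
        ((!₂[x 0, x 1] : EuclideanSpace ℝ (Fin 2)) 1) * h (x 2)) =
      productSolution V h (m := 0) := by
    funext x
    simp [productSolution]
  refine ⟨fun n hn => ?_, fun x => homogeneousExtension V (x 0) (x 1), h,
    ⟨contDiff_two_of_hasDerivAt hh hh' hc, fun s => ⟨hpos s, ?_⟩⟩, hV.coordinateConvex_extension,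
    fun x => hV.extension_nonneg _ _, fun r x hr => homogeneousExtension_smul V hr _ _,
    ⟨hV.contDiffOn_extension, fun x hx => hV.extension_mul_secondPartials hx⟩, ?_, ?_⟩
  · obtain ⟨m, rfl⟩ := Nat.exists_eq_add_of_le' hn
    exact ⟨productSolution V h, isGlobalViscositySolution_productSolution hV hh hh' hpos heq,
      not_contDiff_productSolution hV hpos⟩
  · rw [iteratedDeriv_two_of_hasDerivAt hh hh', heq]
  · exact e3 ▸ isGlobalViscositySolution_productSolution hV hh hh' hpos heq
  · exact e3 ▸ not_contDiff_productSolution hV hpos
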